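/- Fix $0<a\le 1$. For $0<q<1$ put $[x]_q=(1-q^x)/(1-q)$ and $$g_q(s,t,a)=\sum_{n=0}^{\infty}\frac{q^{(n+a)t}}{[n+a]_q^{\,s}}\qquad(s,t\in\mathbb{C},\ \operatorname{Re} t>0),$$ a series that converges absolutely. For every $0<q<1$ the function $g_q(s,t,a)$ has a meromorphic continuation to all $(s,t)\in\mathbb{C}^2$, holomorphic wherever $t\notin P_q:=\{-k+2\pi i m/\log q : k\in\mathbb{Z}_{\ge 0},\ m\in\mathbb{Z}\}$; it is denoted by the same symbol. Let $\zeta(s,a)$ be the (meromorphically continued) Hurwitz zeta function. Let $\varphi$ be a meromorphic function on $\mathbb{C}$. We say that $g_q(\cdot,\varphi(\cdot),a)$ is *regular* at $s_0\in\mathbb{C}$ if $\varphi(s)\notin P_q$ for all $s\neq s_0$ near $s_0$, and the function $s\mapsto g_q(s,\varphi(s),a)$ on a punctured neighbourhood of $s_0$ extends holomorphically to $s_0$; the value at $s_0$ is then that of the extension. We call $g_q(s,\varphi(s),a)$ a *true $q$-analogue* of $\zeta(s,a)$ if * for all $s\in\mathbb{C}$ outside a closed discrete set, $g_q(\cdot,\varphi(\cdot),a)$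 is regular at $s$ for all $q<1$ sufficiently close to $1$, and * $\displaystyle\lim_{q\uparrow1}g_q(s,\varphi(s),a)=\zeta(s,a)$ for every $s\in\mathbb{C}\setminus\{1\}$ such that $g_q(\cdot,\varphi(\cdot),a)$ is regular at $s$ for all $q<1$ sufficiently close to $1$. **Theorem.** $g_q(s,\varphi(s),a)$ is a true $q$-analogue of $\zeta(s,a)$ if and only if $\varphi(s)=s-\nu$ (as meromorphic functions) for some integer $\nu\ge1$. Moreover, for every integer $\nu\ge 1$ and every $s\in\mathbb{C}\setminus\{1,2,\dots,\nu\}$, the function $g_q(\cdot,\,\cdot-\nu,a)$ is regular at $s$ for all $q<1$ sufficiently close to $1$, and $\lim_{q\uparrow1}g_q(s,s-\nu,a)=\zeta(s,a)$. -/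

import Mathlib

open Filter Topology

/-- The `q`-number `[x]_q = (1 - q ^ x) / (1 - q)` of a real number `x`. -/
noncomputable def qNumber (q x : ℝ) : ℝ := (1 - q ^ x) / (1 - q)

/-- The `n`-th term `q ^ ((n + a) t) [n + a]_q ^ (-s)` of the `q`-Hurwitz series `g_q(s, t, a)`. -/
noncomputable def qHurwitzTerm (q a : ℝ) (s t : ℂ) (n : ℕ) : ℂ :=
  (q : ℂ) ^ (((n : ℂ) + (a : ℂ)) * t) * ((qNumber q ((n : ℝ) + a) : ℝ) : ℂ) ^ (-s)

/-- For `0 < q < 1`, the set of all `t = -k + 2 π i m / log q` with `k ∈ {0, 1, 2, …}` and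
`m ∈ ℤ`, written as the set of solutions of `q ^ (t + k) = 1`. -/
def qPolarSet (q : ℝ) : Set ℂ := {t | ∃ k : ℕ, (q : ℂ) ^ (t + (k : ℂ)) = 1}

/-- A function of two complex variables is meromorphic at a point if near this point it is a
quotient of two holomorphic functions, the denominator of which does not vanish identically. -/
def MeromorphicAtTwo (G : ℂ → ℂ → ℂ) (p : ℂ × ℂ) : Prop :=
  ∃ A B : ℂ × ℂ → ℂ,
    (∀ᶠ x in 𝓝 p, DifferentiableAt ℂ A x ∧ DifferentiableAt ℂ B x) ∧
    (∃ᶠ x in 𝓝 p, B x ≠ 0) ∧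
    ∀ᶠ x in 𝓝 p, B x ≠ 0 → G x.1 x.2 = A x / B x

/-- `G` is the meromorphic continuation to `ℂ × ℂ` of `(s, t) ↦ g_q(s, t, a)`: it is the sum of
the (absolutely convergent) `q`-Hurwitz series for `Re t > 0`, it is holomorphic at every `(s, t)`
with `t` outside `qPolarSet q`, and it is meromorphic everywhere.  This determines `G` uniquely
at all `(s, t)` with `t` outside `qPolarSet q`; other values of `G` are never used below. -/
structure IsQHurwitz (q a : ℝ) (G : ℂ → ℂ → ℂ) : Prop where
  hasSum : ∀ s t : ℂ, 0 < t.re → HasSum (qHurwitzTerm q a s t) (G s t)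
  holomorphic : ∀ s t : ℂ, t ∉ qPolarSet q →
    DifferentiableAt ℂ (fun x : ℂ × ℂ ↦ G x.1 x.2) (s, t)
  meromorphic : ∀ p : ℂ × ℂ, MeromorphicAtTwo G p

/-- The one-variable function `z ↦ G z (φ z)`, where `G = g_q(·, ·, a)`, is holomorphic at `s`:
near `s`, except possibly at `s` itself, the graph of `φ` avoids the polar set, and
`z ↦ G z (φ z)` extends holomorphically to `s`. -/
def RegularAlong (q : ℝ) (G : ℂ → ℂ → ℂ) (φ : ℂ → ℂ) (s : ℂ) : Prop :=
  (∀ᶠ z in 𝓝[≠] s, φ z ∉ qPolarSet q) ∧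
    ∃ F : ℂ → ℂ, AnalyticAt ℂ F s ∧ F =ᶠ[𝓝[≠] s] fun z ↦ G z (φ z)

/-- The value at `s` of the one-variable function `z ↦ G z (φ z)` with its removable
singularities removed. -/
noncomputable def valueAlong (G : ℂ → ℂ → ℂ) (φ : ℂ → ℂ) (s : ℂ) : ℂ :=
  limUnder (𝓝[≠] s) fun z ↦ G z (φ z)

/-- `g_q(s, φ(s), a)`, with `g_q(·, ·, a)` given as `G q`, is a true `q`-analogue of `ζ(s, a)`.
First, for all `s` outside a closed discrete set, `g_q(·, φ(·), a)` is defined and holomorphic at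
`s` for all `q < 1` close to `1`.  Second, `lim_{q ↑ 1} g_q(s, φ(s), a) = ζ(s, a)` at every such
`s`, apart from the pole `s = 1` of `ζ(s, a)`. -/
def IsTrueQAnalogue (a : ℝ) (G : ℝ → ℂ → ℂ → ℂ) (φ : ℂ → ℂ) : Prop :=
  (∀ᶠ s in codiscrete ℂ, ∀ᶠ q in 𝓝[<] (1 : ℝ), RegularAlong q (G q) φ s) ∧
    ∀ s : ℂ, s ≠ 1 → (∀ᶠ q in 𝓝[<] (1 : ℝ), RegularAlong q (G q) φ s) →
      Tendsto (fun q ↦ valueAlong (G q) φ s) (𝓝[<] (1 : ℝ))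
        (𝓝 (HurwitzZeta.hurwitzZeta (a : UnitAddCircle) s))

/-! Expanding `(1 - q^(n+a))^(-s)` by the binomial theorem and summing over `n` first gives
`g_q(s,t,a) = (1-q)^s ∑_r c_r(s) q^(a(t+r)) / (1 - q^(t+r))`, where `c_r(s)` is `risingCoeff s r`.
The coefficients grow polynomially in `r`, so away from the zeros of the denominators the series
converges locally uniformly. This is the continuation `qHurwitz`. By the identity theorem in `t` it
agrees off the polar set with any other function satisfying `IsQHurwitz` (`IsQHurwitz.eq_qHurwitz`).

Sufficiency. For `t = s - 1` the function `q^(z(s-1)) (1-q^z)^(-s)` has an elementary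
antiderivative, a multiple of `(q^(-z) - 1)^(1-s)`. The Abel–Plana formula on the line `Re z = a +
1/2` therefore turns `g_q(s, s-1, a)` into a closed main term plus an integral against
`1/(e^(2πy)+1)` (`qHurwitz_eq_qHermite`). This expression makes sense for all `s ≠ 1` once `q` is
close to `1`, with bounds uniform in `q`, so it converges to a Hermite formula. For `Re s > 2` the
`q`-series itself converges to the Hurwitz series, hence the Hermite formula is `ζ(s,a)` there, and
everywhere by analytic continuation. The identity `g_q(s,t) = g_q(s,t+1) + (1-q) g_q(s-1,t)` carries
the limit from `ν` to `ν + 1`, its last term vanishing as `q ↑ 1`. At `1, …, ν` there is a genuine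
pole for every `q`, so the limit condition says nothing at these points.

Necessity. For real `0 < x < 1`, `(-log q) ∑_r c_r(x) q^(a(t+r)) / (1 - q^(t+r))` tends to `∑_r
c_r(x)/(t+r) = B(t, 1-x)`. The factor `(1-q)^x / (-log q)` in front is unbounded, so a finite limit
of `g_q(x,t,a)` forces `B(t, 1-x) = 0`, that is, `t = x - ν` with `ν ≥ 1`. If a meromorphic `φ` were
none of the functions `s - ν`, it would avoid all of them and all the constants `-k` outside a
countable set. A single real `x` in `(0,1)` off that set gives a contradiction. -/

/-! ### Binomial coefficients and dominated series -/

/-- The coefficient `s (s + 1) ⋯ (s + r - 1) / r!` of `x ^ r` in `(1 - x) ^ (-s)`. -/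
noncomputable def risingCoeff (s : ℂ) (r : ℕ) : ℂ := ∏ j ∈ Finset.range r, (s + j) / (j + 1)

theorem risingCoeff_zero (s : ℂ) : risingCoeff s 0 = 1 := by simp [risingCoeff]

theorem risingCoeff_succ (s : ℂ) (r : ℕ) :
    risingCoeff s (r + 1) = risingCoeff s r * ((s + r) / (r + 1)) := by
  simp only [risingCoeff, Finset.prod_range_succ]

theorem risingCoeff_sub_one_succ (s : ℂ) (r : ℕ) :
    risingCoeff (s - 1) (r + 1) = (s - 1) / (r + 1) * risingCoeff s r := by
  induction r with
  | zero => simp [risingCoeff]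
  | succ r ih =>
    rw [risingCoeff_succ, ih, risingCoeff_succ s r]
    have h1 : (r : ℂ) + 1 ≠ 0 := by exact_mod_cast r.succ_ne_zero
    have h2 : (r : ℂ) + 1 + 1 ≠ 0 := by exact_mod_cast (r + 1).succ_ne_zero
    push_cast
    field_simp
    ring

/-- Pascal's rule: compare coefficients in `(1-x) (1-x)^(-s) = (1-x)^(-(s-1))`. It is the source of
the recurrence `qHurwitz_eq_add`. -/
theorem risingCoeff_succ_sub (s : ℂ) (r : ℕ) :
    risingCoeff s (r + 1) - risingCoeff s r = risingCoeff (s - 1) (r + 1) := by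
  rw [risingCoeff_sub_one_succ, risingCoeff_succ]
  have h1 : (r : ℂ) + 1 ≠ 0 := by exact_mod_cast r.succ_ne_zero
  field_simp
  ring

theorem risingCoeff_natCast_ne_zero {j : ℕ} (hj : 1 ≤ j) (r : ℕ) : risingCoeff j r ≠ 0 := by
  refine Finset.prod_ne_zero_iff.mpr fun i _ ↦ div_ne_zero ?_ ?_
  · exact_mod_cast (by omega : j + i ≠ 0)
  · exact_mod_cast i.succ_ne_zero

theorem differentiable_risingCoeff (r : ℕ) : Differentiable ℂ fun s ↦ risingCoeff s r := by
  unfold risingCoeff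
  fun_prop

/-- The bound is `c_r(N+1)`, obtained by replacing `s` with `N + 1` in every factor. It grows
polynomially in `r`, locally uniformly in `s`, so any geometric factor makes the series converge. -/
theorem norm_risingCoeff_le {s : ℂ} {N : ℕ} (hs : ‖s‖ ≤ N + 1) (r : ℕ) :
    ‖risingCoeff s r‖ ≤ (r + N).choose N := by
  induction r with
  | zero => simp [risingCoeff]
  | succ r ih =>
    have h1 : (0 : ℝ) < r + 1 := by positivity
    have h2 : ‖(s + r) / ((r : ℂ) + 1)‖ ≤ (r + N + 1) / (r + 1) := by
      rw [norm_div, show ‖(r : ℂ) + 1‖ = r + 1 by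
        rw [show (r : ℂ) + 1 = ((r + 1 : ℕ) : ℂ) by push_cast; rfl, Complex.norm_natCast]; simp]
      gcongr
      refine (norm_add_le _ _).trans ?_
      rw [Complex.norm_natCast]
      linarith
    have h3 : ((r + 1 + N).choose N : ℝ) = (r + N).choose N * ((r + N + 1) / (r + 1)) := by
      have := Nat.add_one_mul_choose_eq (r + N) r
      rw [← Nat.choose_symm_of_eq_add (show r + N = r + N from rfl),
        ← Nat.choose_symm_of_eq_add (show r + 1 + N = (r + 1) + N from rfl)]
      have h4 : ((r + N + 1 : ℕ) : ℝ) * ((r + N).choose r) =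
          ((r + N + 1).choose (r + 1)) * (r + 1 : ℕ) := by
        exact_mod_cast this
      rw [show r + 1 + N = r + N + 1 by ring]
      field_simp
      push_cast at h4
      linarith
    rw [risingCoeff_succ, norm_mul, h3]
    gcongr

theorem risingCoeff_eq_choose (s : ℂ) (r : ℕ) : risingCoeff s r = Ring.choose (s + r - 1) r := by
  rw [← Ring.multichoose_eq]
  have h : ∀ r : ℕ, (r.factorial : ℂ) * risingCoeff s r = (ascPochhammer ℂ r).eval s := by
    intro r
    induction r with
    | zero => simp [risingCoeff]
    | succ r ih =>
      have h1 : (r : ℂ) + 1 ≠ 0 := by exact_mod_cast r.succ_ne_zero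
      rw [ascPochhammer_succ_eval, ← ih, risingCoeff_succ, Nat.factorial_succ]
      push_cast
      field_simp
  have h2 := Ring.factorial_nsmul_multichoose_eq_ascPochhammer s r
  rw [Polynomial.ascPochhammer_smeval_eq_eval, ← h r, nsmul_eq_mul] at h2
  exact (mul_left_cancel₀ (by exact_mod_cast r.factorial_ne_zero) h2).symm

theorem hasSum_risingCoeff_mul_pow (s : ℂ) {x : ℂ} (hx : ‖x‖ < 1) :
    HasSum (fun r : ℕ ↦ risingCoeff s r * x ^ r) ((1 - x) ^ (-s)) := by
  have h := (Complex.one_div_one_sub_cpow_hasFPowerSeriesOnBall_zero s).hasSum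
    (y := x) (by simpa [enorm_eq_nnnorm, ← NNReal.coe_lt_coe] using hx)
  simp only [zero_add, FormalMultilinearSeries.ofScalars_apply_eq, smul_eq_mul, one_div,
    ← Complex.cpow_neg] at h
  simpa only [risingCoeff_eq_choose] using h

theorem exists_norm_le_natCast_add_one (s : ℂ) : ∃ N : ℕ, ‖s‖ ≤ N + 1 := by
  obtain ⟨N, hN⟩ := exists_nat_ge ‖s‖
  exact ⟨N, by linarith⟩

theorem summable_choose_mul_pow (N : ℕ) {x : ℝ} (h0 : 0 ≤ x) (h1 : x < 1) :
    Summable fun r : ℕ ↦ ((r + N).choose N : ℝ) * x ^ r :=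
  summable_choose_mul_geometric_of_norm_lt_one N (by rwa [Real.norm_of_nonneg h0])

/-- The sum of a series of holomorphic functions on a ball of a complex normed space, dominated by
a summable sequence, is differentiable at the centre. -/
theorem differentiableAt_tsum_of_norm_le {E : Type*} [NormedAddCommGroup E] [NormedSpace ℂ E]
    {f : ℕ → E → ℂ} {u : ℕ → ℝ} (hu : Summable u) {x₀ : E} {R : ℝ} (hR : 0 < R)
    (hf : ∀ n, DifferentiableOn ℂ (f n) (Metric.ball x₀ R))
    (hb : ∀ n, ∀ x ∈ Metric.ball x₀ R, ‖f n x‖ ≤ u n) :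
    DifferentiableAt ℂ (fun x ↦ ∑' n, f n x) x₀ := by
  have hd : ∀ n, ∀ x ∈ Metric.ball x₀ R, DifferentiableAt ℂ (f n) x := fun n x hx ↦
    (hf n).differentiableAt (Metric.isOpen_ball.mem_nhds hx)
  have hu0 : ∀ n, 0 ≤ u n := fun n ↦ (norm_nonneg _).trans (hb n x₀ (Metric.mem_ball_self hR))
  have hsub : Metric.ball x₀ (R / 2) ⊆ Metric.ball x₀ R := Metric.ball_subset_ball (by linarith)
  -- Cauchy's estimate on the complex line through `x` in direction `v`: the disc of radius `R /
  -- (4‖v‖)` keeps `x + z • v` inside the big ball.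
  have hbound : ∀ n, ∀ x ∈ Metric.ball x₀ (R / 2), ‖fderiv ℂ (f n) x‖ ≤ u n * (4 / R) := by
    intro n x hx
    refine ContinuousLinearMap.opNorm_le_bound _ (mul_nonneg (hu0 n) (by positivity)) fun v ↦ ?_
    by_cases hv : v = 0
    · simp [hv]
    have hv0 : 0 < ‖v‖ := norm_pos_iff.mpr hv
    have hmem : ∀ z ∈ Metric.closedBall (0 : ℂ) (R / 4 / ‖v‖), x + z • v ∈ Metric.ball x₀ R := by
      intro z hz
      rw [mem_closedBall_zero_iff, le_div_iff₀ hv0] at hz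
      rw [mem_ball_iff_norm] at hx ⊢
      calc ‖x + z • v - x₀‖ = ‖(x - x₀) + z • v‖ := by congr 1; abel
        _ ≤ ‖x - x₀‖ + ‖z‖ * ‖v‖ := (norm_add_le _ _).trans (by rw [norm_smul])
        _ < R := by linarith
    have hg : ∀ z ∈ Metric.closedBall (0 : ℂ) (R / 4 / ‖v‖),
        HasDerivAt (fun z ↦ f n (x + z • v)) (fderiv ℂ (f n) (x + z • v) v) z := by
      intro z hz
      have h1 : HasDerivAt (fun z : ℂ ↦ x + z • v) v z := by
        simpa using ((hasDerivAt_id z).smul_const v).const_add x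
      exact (hd n _ (hmem z hz)).hasFDerivAt.comp_hasDerivAt z h1
    have hpos : 0 < R / 4 / ‖v‖ := by positivity
    have hdc : DiffContOnCl ℂ (fun z : ℂ ↦ f n (x + z • v)) (Metric.ball 0 (R / 4 / ‖v‖)) := by
      refine DifferentiableOn.diffContOnCl fun z hz ↦ ?_
      rw [closure_ball _ hpos.ne'] at hz
      exact (hg z hz).differentiableAt.differentiableWithinAt
    have h2 := Complex.norm_deriv_le_of_forall_mem_sphere_norm_le hpos hdc (C := u n)
      fun z hz ↦ hb n _ (hmem z (Metric.sphere_subset_closedBall hz))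
    rw [(hg 0 (Metric.mem_closedBall_self hpos.le)).deriv, zero_smul, add_zero] at h2
    refine h2.trans_eq ?_
    field_simp
  refine (hasFDerivAt_tsum_of_isPreconnected (hu.mul_right (4 / R)) Metric.isOpen_ball
    (convex_ball x₀ (R / 2)).isPreconnected (fun n x hx ↦ (hd n x (hsub hx)).hasFDerivAt)
    hbound (Metric.mem_ball_self (by positivity)) ?_
    (Metric.mem_ball_self (by positivity))).differentiableAt
  exact Summable.of_norm_bounded hu fun n ↦ hb n _ (Metric.mem_ball_self hR)

/-! ### The continuation of `g_q` by the binomial expansion -/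

/-- The sum `q ^ (a w) / (1 - q ^ w)` of the geometric series `∑ q ^ ((n + a) w)`. -/
noncomputable def qGeom (q a : ℝ) (w : ℂ) : ℂ := (q : ℂ) ^ ((a : ℂ) * w) / (1 - (q : ℂ) ^ w)

/-- The expansion of `g_q(s, t, a)` as a series of functions meromorphic on `ℂ × ℂ`. -/
noncomputable def qHurwitz (q a : ℝ) (s t : ℂ) : ℂ :=
  ((1 - q : ℝ) : ℂ) ^ s * ∑' r : ℕ, risingCoeff s r * qGeom q a (t + r)

section

variable {q a : ℝ}

theorem norm_ofReal_cpow_mul (hq0 : 0 < q) (a : ℝ) (w : ℂ) :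
    ‖(q : ℂ) ^ ((a : ℂ) * w)‖ = q ^ (a * w.re) := by
  rw [Complex.norm_cpow_eq_rpow_re_of_pos hq0, Complex.re_ofReal_mul]

theorem norm_qGeom_le (hq0 : 0 < q) (hq1 : q < 1) (a : ℝ) {w : ℂ} (hw : 1 ≤ w.re) :
    ‖qGeom q a w‖ ≤ q ^ (a * w.re) / (1 - q) := by
  rw [qGeom, norm_div, norm_ofReal_cpow_mul hq0]
  have h1 : ‖(q : ℂ) ^ w‖ ≤ q := by
    rw [Complex.norm_cpow_eq_rpow_re_of_pos hq0]
    simpa using Real.rpow_le_rpow_of_exponent_ge hq0 hq1.le hw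
  have h2 : 1 - q ≤ ‖1 - (q : ℂ) ^ w‖ := by
    have := norm_sub_norm_le (1 : ℂ) ((q : ℂ) ^ w)
    rw [norm_one] at this
    linarith
  have : 0 < 1 - q := by linarith
  gcongr

theorem norm_risingCoeff_mul_qGeom_le (hq0 : 0 < q) (hq1 : q < 1) (ha : 0 < a) {s t : ℂ} {N : ℕ}
    (hs : ‖s‖ ≤ N + 1) {τ : ℝ} (hτ : τ ≤ t.re) {r : ℕ} (hr : 1 ≤ t.re + r) :
    ‖risingCoeff s r * qGeom q a (t + r)‖ ≤
      (r + N).choose N * (q ^ a) ^ r * (q ^ (a * τ) / (1 - q)) := by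
  have h1 : 0 < 1 - q := by linarith
  have h2 := norm_qGeom_le hq0 hq1 a (w := t + r) (by simpa using hr)
  have h3 : q ^ (a * (t + r).re) ≤ (q ^ a) ^ r * q ^ (a * τ) := by
    rw [← Real.rpow_natCast, ← Real.rpow_mul hq0.le, ← Real.rpow_add hq0]
    refine Real.rpow_le_rpow_of_exponent_ge hq0 hq1.le ?_
    simp only [Complex.add_re, Complex.natCast_re]
    nlinarith
  rw [norm_mul, mul_assoc]
  refine mul_le_mul (norm_risingCoeff_le hs r) (h2.trans ?_) (norm_nonneg _) (by positivity)
  rw [← mul_div_assoc]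
  gcongr

theorem summable_majorant (hq0 : 0 < q) (hq1 : q < 1) (ha : 0 < a) (N : ℕ) (C : ℝ) :
    Summable fun r : ℕ ↦ ((r + N).choose N : ℝ) * (q ^ a) ^ r * C :=
  (summable_choose_mul_pow N (Real.rpow_nonneg hq0.le a)
    (Real.rpow_lt_one hq0.le hq1 ha)).mul_right C

theorem summable_risingCoeff_mul_qGeom (hq0 : 0 < q) (hq1 : q < 1) (ha : 0 < a) (s t : ℂ) :
    Summable fun r : ℕ ↦ risingCoeff s r * qGeom q a (t + r) := by
  obtain ⟨N, hN⟩ := exists_norm_le_natCast_add_one s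
  obtain ⟨R, hR⟩ := exists_nat_ge (1 - t.re)
  refine Summable.of_norm_bounded_eventually_nat
    (summable_majorant hq0 hq1 ha N (q ^ (a * t.re) / (1 - q))) ?_
  filter_upwards [eventually_ge_atTop R] with r hr
  have : (R : ℝ) ≤ r := by exact_mod_cast hr
  exact norm_risingCoeff_mul_qGeom_le hq0 hq1 ha hN le_rfl (by linarith)

theorem differentiableAt_ofReal_cpow (hq0 : 0 < q) {E : Type*} [NormedAddCommGroup E]
    [NormedSpace ℂ E] {f : E → ℂ} {x : E} (hf : DifferentiableAt ℂ f x) :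
    DifferentiableAt ℂ (fun x ↦ (q : ℂ) ^ f x) x :=
  hf.const_cpow (Or.inl (by exact_mod_cast hq0.ne'))

theorem differentiableAt_qGeom (hq0 : 0 < q) {E : Type*} [NormedAddCommGroup E]
    [NormedSpace ℂ E] {f : E → ℂ} {x : E} (hf : DifferentiableAt ℂ f x)
    (h : (q : ℂ) ^ f x ≠ 1) :
    DifferentiableAt ℂ (fun x ↦ qGeom q a (f x)) x :=
  DifferentiableAt.comp x (((differentiableAt_ofReal_cpow hq0 (differentiableAt_id.const_mul _)).div
    ((differentiableAt_ofReal_cpow hq0 differentiableAt_id).const_sub 1)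
    (sub_ne_zero.mpr h.symm) :) : DifferentiableAt ℂ (qGeom q a) (f x)) hf

theorem differentiable_prod_one_sub_cpow (hq0 : 0 < q) (u : Finset ℕ) :
    Differentiable ℂ fun t : ℂ ↦ ∏ r ∈ u, (1 - (q : ℂ) ^ (t + r)) := fun _ ↦
  DifferentiableAt.fun_finsetProd fun _ _ ↦
    (differentiableAt_ofReal_cpow hq0 (differentiableAt_id.add_const _)).const_sub 1

theorem ofReal_cpow_ne_one (hq0 : 0 < q) (hq1 : q < 1) {w : ℂ} (hw : w.re ≠ 0) :
    (q : ℂ) ^ w ≠ 1 := by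
  intro h
  have h1 := congrArg norm h
  rw [Complex.norm_cpow_eq_rpow_re_of_pos hq0, norm_one] at h1
  rcases hw.lt_or_gt with h2 | h2
  · exact (Real.one_lt_rpow_of_pos_of_lt_one_of_neg hq0 hq1 h2).ne' h1
  · exact (Real.rpow_lt_one hq0.le hq1 h2).ne h1

/-- On the unit ball about `(s₀, t₀)` every exponent `x.2 + r + R` has real part at least `1`, so no
denominator vanishes and one majorant serves all terms. -/
theorem differentiableAt_qHurwitz_tail (hq0 : 0 < q) (hq1 : q < 1) (ha : 0 < a) (s₀ t₀ : ℂ)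
    {R : ℕ} (hR : 2 ≤ t₀.re + R) :
    DifferentiableAt ℂ (fun x : ℂ × ℂ ↦ ∑' r : ℕ, risingCoeff x.1 (r + R) *
      qGeom q a (x.2 + (r + R : ℕ))) (s₀, t₀) := by
  obtain ⟨N, hN⟩ := exists_nat_ge ‖s₀‖
  have hx : ∀ x ∈ Metric.ball (s₀, t₀) (1 : ℝ), ‖x.1‖ ≤ N + 1 ∧ t₀.re - 1 ≤ x.2.re := by
    intro x hx
    rw [mem_ball_iff_norm, Prod.norm_def, max_lt_iff] at hx
    constructor
    · have := norm_le_norm_add_norm_sub' x.1 s₀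
      simp only [Prod.fst_sub] at hx
      linarith [hx.1]
    · have := (abs_le.mp (Complex.abs_re_le_norm (x - (s₀, t₀)).2)).1
      simp only [Prod.snd_sub, Complex.sub_re] at this hx
      linarith [hx.2]
  refine differentiableAt_tsum_of_norm_le (((summable_nat_add_iff R).mpr
    (summable_majorant hq0 hq1 ha N (q ^ (a * (t₀.re - 1)) / (1 - q))))) one_pos ?_ ?_
  · intro r x hxb
    have h1 := (hx x hxb).2
    refine DifferentiableAt.differentiableWithinAt ?_
    refine ((differentiable_risingCoeff _).differentiableAt.comp x differentiableAt_fst).mul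
      (differentiableAt_qGeom hq0 (by fun_prop) (ofReal_cpow_ne_one hq0 hq1 ?_))
    push_cast
    simp only [Complex.add_re, Complex.natCast_re]
    have : (0 : ℝ) ≤ r := r.cast_nonneg
    linarith
  · intro r x hxb
    refine norm_risingCoeff_mul_qGeom_le hq0 hq1 ha (hx x hxb).1 (hx x hxb).2 ?_
    have : (0 : ℝ) ≤ r := r.cast_nonneg
    push_cast
    linarith [(hx x hxb).2]

theorem qHurwitz_eq_sum_add_tail (hq0 : 0 < q) (hq1 : q < 1) (ha : 0 < a) (s t : ℂ) (R : ℕ) :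
    qHurwitz q a s t = ((1 - q : ℝ) : ℂ) ^ s *
      (∑ r ∈ Finset.range R, risingCoeff s r * qGeom q a (t + r) +
        ∑' r : ℕ, risingCoeff s (r + R) * qGeom q a (t + (r + R : ℕ))) := by
  rw [qHurwitz, (summable_risingCoeff_mul_qGeom hq0 hq1 ha s t).sum_add_tsum_nat_add]

theorem exists_two_le_add_natCast (x : ℝ) : ∃ R : ℕ, 2 ≤ x + R := by
  obtain ⟨R, hR⟩ := exists_nat_ge (2 - x)
  exact ⟨R, by linarith⟩

theorem differentiableAt_qHurwitz (hq0 : 0 < q) (hq1 : q < 1) (ha : 0 < a) {s t : ℂ}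
    (ht : t ∉ qPolarSet q) :
    DifferentiableAt ℂ (fun x : ℂ × ℂ ↦ qHurwitz q a x.1 x.2) (s, t) := by
  obtain ⟨R, hR⟩ := exists_two_le_add_natCast t.re
  simp only [qHurwitz_eq_sum_add_tail hq0 hq1 ha _ _ R]
  refine (differentiableAt_ofReal_cpow (sub_pos.mpr hq1) differentiableAt_fst).mul
    (DifferentiableAt.add ?_ (differentiableAt_qHurwitz_tail hq0 hq1 ha s t hR))
  refine DifferentiableAt.fun_sum fun r _ ↦ ?_
  exact ((differentiable_risingCoeff _).differentiableAt.comp (s, t) differentiableAt_fst).mul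
      (differentiableAt_qGeom hq0 (by fun_prop) fun h ↦ ht ⟨r, h⟩)

theorem meromorphicAtTwo_qHurwitz (hq0 : 0 < q) (hq1 : q < 1) (ha : 0 < a) (p : ℂ × ℂ) :
    MeromorphicAtTwo (qHurwitz q a) p := by
  obtain ⟨s, t⟩ := p
  -- The extra `- 1` makes the tail holomorphic at every point with `Re > Re t - 1`, not only at
  -- `(s, t)`. The product `B` clears the denominators of the first `R` terms.
  obtain ⟨R, hR⟩ := exists_two_le_add_natCast (t.re - 1)
  set T : ℂ × ℂ → ℂ := fun x ↦ ∑' r : ℕ, risingCoeff x.1 (r + R) *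
      qGeom q a (x.2 + (r + R : ℕ))
  set B : ℂ × ℂ → ℂ := fun x ↦ ∏ r ∈ Finset.range R, (1 - (q : ℂ) ^ (x.2 + r))
  have hB : Differentiable ℂ B :=
    (differentiable_prod_one_sub_cpow hq0 (Finset.range R)).comp differentiable_snd
  refine ⟨fun x ↦ ((1 - q : ℝ) : ℂ) ^ x.1 * (∑ r ∈ Finset.range R, risingCoeff x.1 r *
      ((q : ℂ) ^ ((a : ℂ) * (x.2 + r)) *
        ∏ i ∈ (Finset.range R).erase r, (1 - (q : ℂ) ^ (x.2 + i))) + B x * T x), B, ?_, ?_, ?_⟩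
  · have hev : ∀ᶠ x : ℂ × ℂ in 𝓝 (s, t), t.re - 1 < x.2.re :=
      (Complex.continuous_re.comp continuous_snd).continuousAt.eventually (lt_mem_nhds (by simp))
    filter_upwards [hev] with x hx
    refine ⟨?_, hB x⟩
    refine (differentiableAt_ofReal_cpow (sub_pos.mpr hq1) differentiableAt_fst).mul
      (DifferentiableAt.add (DifferentiableAt.fun_sum fun r _ ↦ ?_) ((hB x).mul
        (differentiableAt_qHurwitz_tail hq0 hq1 ha x.1 x.2 (by linarith))))
    refine ((differentiable_risingCoeff _).differentiableAt.comp x differentiableAt_fst).mul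
      ((differentiableAt_ofReal_cpow hq0 (by fun_prop)).mul
        ((differentiable_prod_one_sub_cpow hq0 _).comp differentiable_snd x))
  -- Moving `t` in the real direction leaves the zeros of `B`, all of which have integral real part.
  · have hpath : Tendsto (fun ε : ℝ ↦ (s, t + (ε : ℂ))) (𝓝[≠] 0) (𝓝 (s, t)) := by
      have : Continuous fun ε : ℝ ↦ (s, t + (ε : ℂ)) := by fun_prop
      simpa using (this.tendsto 0).mono_left nhdsWithin_le_nhds
    refine hpath.frequently (Eventually.frequently ?_)
    have hne : ∀ r ∈ Finset.range R, ∀ᶠ ε : ℝ in 𝓝[≠] 0, ε ≠ -(t.re + r) := by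
      intro r _
      by_cases h : -(t.re + r) = 0
      · rw [h]; exact self_mem_nhdsWithin
      · exact nhdsWithin_le_nhds (isOpen_ne.mem_nhds (Ne.symm h))
    filter_upwards [(Filter.eventually_all_finset _).mpr hne] with ε hε
    refine Finset.prod_ne_zero_iff.mpr fun r hr ↦ sub_ne_zero.mpr
      (ofReal_cpow_ne_one hq0 hq1 ?_).symm
    simp only [Complex.add_re, Complex.ofReal_re, Complex.natCast_re]
    intro h
    exact hε r hr (by linarith)
  · refine Eventually.of_forall fun x hx ↦ ?_
    rw [eq_div_iff hx, qHurwitz_eq_sum_add_tail hq0 hq1 ha _ _ R, mul_assoc, add_mul,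
      Finset.sum_mul]
    dsimp only
    rw [mul_comm (B x)]
    congr 2
    refine Finset.sum_congr rfl fun r hr ↦ ?_
    have h1 : 1 - (q : ℂ) ^ (x.2 + r) ≠ 0 := Finset.prod_ne_zero_iff.mp hx r hr
    have h2 : B x = (1 - (q : ℂ) ^ (x.2 + r)) *
        ∏ i ∈ (Finset.range R).erase r, (1 - (q : ℂ) ^ (x.2 + i)) :=
      (Finset.mul_prod_erase _ _ hr).symm
    rw [mul_assoc, qGeom, div_mul_eq_mul_div, h2]
    field_simp

theorem ofReal_cpow_add (hq0 : 0 < q) (z w : ℂ) : (q : ℂ) ^ (z + w) = (q : ℂ) ^ z * (q : ℂ) ^ w :=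
  Complex.cpow_add _ _ (by exact_mod_cast hq0.ne')

theorem hasSum_qGeom (hq0 : 0 < q) (hq1 : q < 1) (a : ℝ) {w : ℂ} (hw : 0 < w.re) :
    HasSum (fun n : ℕ ↦ (q : ℂ) ^ (((n : ℂ) + a) * w)) (qGeom q a w) := by
  have h1 : ‖(q : ℂ) ^ w‖ < 1 := by
    rw [Complex.norm_cpow_eq_rpow_re_of_pos hq0]
    exact Real.rpow_lt_one hq0.le hq1 hw
  have h2 := (hasSum_geometric_of_norm_lt_one h1).mul_left ((q : ℂ) ^ ((a : ℂ) * w))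
  rw [← div_eq_mul_inv] at h2
  refine h2.congr_fun fun n ↦ ?_
  rw [add_mul, ofReal_cpow_add hq0, Complex.cpow_nat_mul, mul_comm]

theorem qNumber_cpow (hq0 : 0 < q) (hq1 : q < 1) {x : ℝ} (hx : 0 < x) (s : ℂ) :
    ((qNumber q x : ℝ) : ℂ) ^ (-s) =
      ((1 - q : ℝ) : ℂ) ^ s * (1 - (q : ℂ) ^ (x : ℂ)) ^ (-s) := by
  have h1 : 0 < 1 - q := by linarith
  have h2 : q ^ x < 1 := Real.rpow_lt_one hq0.le hq1 hx
  rw [qNumber, div_eq_mul_inv, Complex.ofReal_mul,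
    Complex.mul_cpow_ofReal_nonneg (by linarith) (by positivity), mul_comm, Complex.ofReal_inv,
    Complex.inv_cpow _ _ (by rw [Complex.arg_ofReal_of_nonneg h1.le]; exact Real.pi_pos.ne),
    Complex.cpow_neg, inv_inv, Complex.ofReal_sub 1 (q ^ x), Complex.ofReal_cpow hq0.le,
    Complex.ofReal_one]

/-- Absolute convergence of the double series, which permits summing over `n` before `r`. The bound
factors because `(n+a)(Re t + r) ≥ (n+a) Re t + a r`. -/
theorem summable_risingCoeff_mul_cpow (hq0 : 0 < q) (hq1 : q < 1) (ha : 0 < a) (s : ℂ) {t : ℂ}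
    (ht : 0 < t.re) : Summable fun p : ℕ × ℕ ↦
      risingCoeff s p.2 * (q : ℂ) ^ (((p.1 : ℂ) + a) * (t + p.2)) := by
  obtain ⟨N, hN⟩ := exists_norm_le_natCast_add_one s
  have h1 : Summable fun n : ℕ ↦ q ^ (a * t.re) * (q ^ t.re) ^ n :=
    (summable_geometric_of_lt_one (Real.rpow_nonneg hq0.le _)
      (Real.rpow_lt_one hq0.le hq1 ht)).mul_left _
  have h2 := summable_majorant hq0 hq1 ha N 1
  refine Summable.of_norm_bounded (h1.mul_of_nonneg h2 (fun n ↦ by positivity)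
    (fun r ↦ by positivity)) fun ⟨n, r⟩ ↦ ?_
  have h3 : ‖(q : ℂ) ^ (((n : ℂ) + a) * (t + r))‖ ≤
      q ^ (a * t.re) * (q ^ t.re) ^ n * (q ^ a) ^ r := by
    rw [show ((n : ℂ) + a) = ((n + a : ℝ) : ℂ) by push_cast; rfl, norm_ofReal_cpow_mul hq0,
      ← Real.rpow_natCast, ← Real.rpow_natCast, ← Real.rpow_mul hq0.le, ← Real.rpow_mul hq0.le,
      ← Real.rpow_add hq0, ← Real.rpow_add hq0]
    refine Real.rpow_le_rpow_of_exponent_ge hq0 hq1.le ?_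
    simp only [Complex.add_re, Complex.natCast_re]
    have : (0 : ℝ) ≤ n * r := by positivity
    linarith
  rw [norm_mul]
  calc _ ≤ ((r + N).choose N : ℝ) * (q ^ (a * t.re) * (q ^ t.re) ^ n * (q ^ a) ^ r) :=
        mul_le_mul (norm_risingCoeff_le hN r) h3 (norm_nonneg _) (by positivity)
    _ = _ := by ring

/-- The binomial series of `(1 - q ^ z) ^ (-s)`, times `q ^ (z t)`. -/
theorem hasSum_risingCoeff_mul_cpow (hq0 : 0 < q) (hq1 : q < 1) (s t : ℂ) {z : ℂ} (hz : 0 < z.re) :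
    HasSum (fun r : ℕ ↦ risingCoeff s r * (q : ℂ) ^ (z * (t + r)))
      ((q : ℂ) ^ (z * t) * (1 - (q : ℂ) ^ z) ^ (-s)) := by
  have h1 : ‖(q : ℂ) ^ z‖ < 1 := by
    rw [Complex.norm_cpow_eq_rpow_re_of_pos hq0]
    exact Real.rpow_lt_one hq0.le hq1 hz
  refine ((hasSum_risingCoeff_mul_pow s h1).mul_left ((q : ℂ) ^ (z * t))).congr_fun fun r ↦ ?_
  rw [← Complex.cpow_nat_mul, mul_add, ofReal_cpow_add hq0, mul_comm (r : ℂ)]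
  ring

theorem hasSum_qHurwitzTerm (hq0 : 0 < q) (hq1 : q < 1) (ha : 0 < a) (s : ℂ) {t : ℂ}
    (ht : 0 < t.re) : HasSum (qHurwitzTerm q a s t) (qHurwitz q a s t) := by
  have hsum := summable_risingCoeff_mul_cpow hq0 hq1 ha s ht
  have hrow : ∀ r : ℕ, HasSum (fun n : ℕ ↦ risingCoeff s r * (q : ℂ) ^ (((n : ℂ) + a) * (t + r)))
      (risingCoeff s r * qGeom q a (t + r)) :=
    fun r ↦ (hasSum_qGeom hq0 hq1 a (by
      simp only [Complex.add_re, Complex.natCast_re]; positivity)).mul_left _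
  have hcol : ∀ n : ℕ, HasSum
      (fun r : ℕ ↦ risingCoeff s r * (q : ℂ) ^ (((n : ℂ) + a) * (t + r)))
      ((q : ℂ) ^ (((n : ℂ) + a) * t) * (1 - (q : ℂ) ^ ((n : ℂ) + a)) ^ (-s)) := fun n ↦
    hasSum_risingCoeff_mul_cpow hq0 hq1 s t (by
      simp only [Complex.add_re, Complex.natCast_re, Complex.ofReal_re]; positivity)
  have h1 := ((Equiv.prodComm ℕ ℕ).hasSum_iff.mpr hsum.hasSum).prod_fiberwise hrow
  have h2 := (hsum.hasSum.prod_fiberwise hcol).mul_left (((1 - q : ℝ) : ℂ) ^ s)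
  rw [← h1.tsum_eq] at h2
  refine h2.congr_fun fun n ↦ ?_
  rw [qHurwitzTerm, qNumber_cpow hq0 hq1 (by positivity)]
  push_cast
  ring

theorem isQHurwitz_qHurwitz (hq0 : 0 < q) (hq1 : q < 1) (ha : 0 < a) :
    IsQHurwitz q a (qHurwitz q a) where
  hasSum s _ ht := hasSum_qHurwitzTerm hq0 hq1 ha s ht
  holomorphic _ _ ht := differentiableAt_qHurwitz hq0 hq1 ha ht
  meromorphic := meromorphicAtTwo_qHurwitz hq0 hq1 ha

/-! ### Uniqueness of the continuation, and the recurrence -/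

theorem countable_qPolarSet (hq0 : 0 < q) (hq1 : q < 1) : (qPolarSet q).Countable := by
  have h : qPolarSet q ⊆ ⋃ k : ℕ, ⋃ m : ℤ,
      {(m * (2 * Real.pi * Complex.I) / (Real.log q : ℂ) - k : ℂ)} := by
    rintro t ⟨k, hk⟩
    have hq : (q : ℂ) ≠ 0 := by exact_mod_cast hq0.ne'
    rw [Complex.cpow_def_of_ne_zero hq, Complex.exp_eq_one_iff, ← Complex.ofReal_log hq0.le] at hk
    obtain ⟨m, hm⟩ := hk
    have hl : (Real.log q : ℂ) ≠ 0 := by exact_mod_cast (Real.log_neg hq0 hq1).ne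
    simp only [Set.mem_iUnion, Set.mem_singleton_iff]
    refine ⟨k, m, ?_⟩
    rw [← hm]
    field_simp
    ring
  exact Set.Countable.mono h
    (Set.countable_iUnion fun k ↦ Set.countable_iUnion fun m ↦ Set.countable_singleton _)

theorem isOpen_compl_qPolarSet (hq0 : 0 < q) (hq1 : q < 1) : IsOpen (qPolarSet q)ᶜ := by
  rw [isOpen_iff_mem_nhds]
  intro t ht
  obtain ⟨R, hR⟩ := exists_two_le_add_natCast t.re
  have h1 : ∀ᶠ z : ℂ in 𝓝 t, t.re - 1 < z.re :=
    Complex.continuous_re.continuousAt.eventually (lt_mem_nhds (by simp))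
  have h2 : ∀ k ∈ Finset.range R, ∀ᶠ z : ℂ in 𝓝 t, (q : ℂ) ^ (z + k) ≠ 1 := fun k _ ↦
    (differentiableAt_ofReal_cpow hq0 (f := fun z ↦ z + (k : ℂ))
      (by fun_prop)).continuousAt.eventually_ne fun h ↦ ht ⟨k, h⟩
  filter_upwards [h1, (Filter.eventually_all_finset _).mpr h2] with z hz1 hz2
  rintro ⟨k, hk⟩
  by_cases hkR : k < R
  · exact hz2 k (Finset.mem_range.mpr hkR) hk
  · refine ofReal_cpow_ne_one hq0 hq1 ?_ hk
    have : (R : ℝ) ≤ k := by exact_mod_cast not_lt.mp hkR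
    simp only [Complex.add_re, Complex.natCast_re]
    linarith

/-- Fix `s`. A countable set does not disconnect the plane, and near `t = 1` both functions are the
sum of the same series, so the identity theorem applies in `t`. -/
theorem IsQHurwitz.eq_qHurwitz {G : ℂ → ℂ → ℂ} (hG : IsQHurwitz q a G) (hq0 : 0 < q) (hq1 : q < 1)
    (ha : 0 < a) (s : ℂ) {t : ℂ} (ht : t ∉ qPolarSet q) : G s t = qHurwitz q a s t := by
  have hopen := isOpen_compl_qPolarSet hq0 hq1
  have han : ∀ {H : ℂ → ℂ → ℂ}, IsQHurwitz q a H → AnalyticOnNhd ℂ (H s) (qPolarSet q)ᶜ := by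
    intro H hH
    refine DifferentiableOn.analyticOnNhd (fun z hz ↦ ?_) hopen
    exact ((hH.holomorphic s z hz).comp z (f := fun z : ℂ ↦ (s, z))
      (by fun_prop)).differentiableWithinAt
  have hconn : IsPreconnected (qPolarSet q)ᶜ :=
    ((countable_qPolarSet hq0 hq1).isConnected_compl_of_one_lt_rank
      (by rw [Complex.rank_real_complex]; norm_num)).isPreconnected
  have h1 : (1 : ℂ) ∈ (qPolarSet q)ᶜ := by
    rintro ⟨k, hk⟩
    refine ofReal_cpow_ne_one hq0 hq1 ?_ hk
    simp only [Complex.add_re, Complex.one_re, Complex.natCast_re]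
    positivity
  have hH := isQHurwitz_qHurwitz hq0 hq1 ha
  refine (han hG).eqOn_of_preconnected_of_eventuallyEq (han hH) hconn h1 ?_ ht
  filter_upwards [Complex.continuous_re.continuousAt.eventually
    (lt_mem_nhds (show (0 : ℝ) < (1 : ℂ).re by simp))] with z hz
  exact (hG.hasSum s z hz).unique (hH.hasSum s z hz)

/-- On summands this is `1 = q^z + (1-q)[z]_q`. It is proved on the expansion, linearly in the
values of `qGeom`, and so holds at poles too, whatever value division by zero assigns there. -/
theorem qHurwitz_eq_add (hq0 : 0 < q) (hq1 : q < 1) (ha : 0 < a) (s t : ℂ) :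
    qHurwitz q a s t = qHurwitz q a s (t + 1) + (1 - q : ℝ) * qHurwitz q a (s - 1) t := by
  have h1 := summable_risingCoeff_mul_qGeom hq0 hq1 ha s t
  have h2 := summable_risingCoeff_mul_qGeom hq0 hq1 ha s (t + 1)
  have h3 := summable_risingCoeff_mul_qGeom hq0 hq1 ha (s - 1) t
  have hε : ((1 - q : ℝ) : ℂ) ≠ 0 := by exact_mod_cast (sub_pos.mpr hq1).ne'
  have h4 : ∑' r : ℕ, risingCoeff s r * qGeom q a (t + r) =
      ∑' r : ℕ, risingCoeff s r * qGeom q a (t + 1 + r) +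
        ∑' r : ℕ, risingCoeff (s - 1) r * qGeom q a (t + r) := by
    rw [h1.tsum_eq_zero_add, h3.tsum_eq_zero_add, add_left_comm,
      ← h2.tsum_add ((summable_nat_add_iff 1).mpr h3)]
    simp only [risingCoeff_zero]
    congr 1
    refine tsum_congr fun r ↦ ?_
    rw [← risingCoeff_succ_sub]
    push_cast
    rw [show t + (r + 1) = t + 1 + r by ring]
    ring
  rw [qHurwitz, qHurwitz, qHurwitz, h4, Complex.cpow_sub _ _ hε, Complex.cpow_one]
  field_simp

end

/-! ### The kernel `1/(e^(2πy)+1)` and Legendre's integral -/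

open MeasureTheory

/-- The kernel `1 / (e ^ (2 π y) + 1)` of the midpoint form of the Abel–Plana formula. -/
noncomputable def abelPlanaKernel (y : ℝ) : ℝ := (Real.exp (2 * Real.pi * y) + 1)⁻¹

theorem abelPlanaKernel_pos (y : ℝ) : 0 < abelPlanaKernel y := by
  unfold abelPlanaKernel
  positivity

theorem abelPlanaKernel_le (y : ℝ) : abelPlanaKernel y ≤ Real.exp (-(2 * Real.pi * y)) := by
  rw [abelPlanaKernel, Real.exp_neg]
  gcongr
  linarith

theorem continuous_abelPlanaKernel : Continuous abelPlanaKernel := by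
  unfold abelPlanaKernel
  exact Continuous.inv₀ (by fun_prop) fun y ↦ by positivity

theorem integral_sin_mul_exp_neg {β : ℂ} {c : ℝ} (h : |β.im| < c) :
    IntegrableOn (fun y : ℝ ↦ Complex.sin (β * y) * Complex.exp (-(c * y))) (Set.Ioi 0) ∧
    ∫ y : ℝ in Set.Ioi 0, Complex.sin (β * y) * Complex.exp (-(c * y)) = β / (β ^ 2 + c ^ 2) := by
  obtain ⟨h1, h2⟩ := abs_lt.mp h
  have hr1 : (-β * Complex.I - c).re < 0 := by simp; linarith
  have hr2 : (β * Complex.I - c).re < 0 := by simp; linarith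
  have e1 := integrableOn_exp_mul_complex_Ioi hr1 0
  have e2 := integrableOn_exp_mul_complex_Ioi hr2 0
  have hfun : (fun y : ℝ ↦ Complex.sin (β * y) * Complex.exp (-(c * y))) = fun y : ℝ ↦
      (Complex.I / 2) * (Complex.exp ((-β * Complex.I - c) * y) -
        Complex.exp ((β * Complex.I - c) * y)) := by
    ext y
    rw [Complex.sin, show (-β * Complex.I - c) * (y : ℂ) = -(β * y) * Complex.I + -(c * y) by ring,
      show (β * Complex.I - c) * (y : ℂ) = (β * y) * Complex.I + -(c * y) by ring,
      Complex.exp_add, Complex.exp_add]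
    ring
  rw [hfun]
  refine ⟨(e1.sub e2).const_mul _, ?_⟩
  rw [integral_const_mul, integral_sub e1 e2, integral_exp_mul_complex_Ioi hr1,
    integral_exp_mul_complex_Ioi hr2]
  have n1 : -β * Complex.I - c ≠ 0 := fun h ↦ by rw [h] at hr1; simp at hr1
  have n2 : β * Complex.I - c ≠ 0 := fun h ↦ by rw [h] at hr2; simp at hr2
  have n3 : β ^ 2 + (c : ℂ) ^ 2 = (-β * Complex.I - c) * (β * Complex.I - c) := by
    linear_combination β ^ 2 * Complex.I_sq
  have n4 : (-β * Complex.I - c) - (β * Complex.I - c) = -2 * β * Complex.I := by ring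
  rw [n3]
  simp only [Complex.ofReal_zero, mul_zero, Complex.exp_zero]
  generalize -β * Complex.I - (c : ℂ) = A at *
  generalize β * Complex.I - (c : ℂ) = B at *
  field_simp
  linear_combination Complex.I * n4 - (2 * β) * Complex.I_sq

theorem norm_sin_mul_le (β : ℂ) {y : ℝ} (hy : 0 ≤ y) :
    ‖Complex.sin (β * y)‖ ≤ Real.exp (|β.im| * y) := by
  have hle : ∀ γ : ℂ, γ.im = β.im ∨ γ.im = -β.im →
      ‖Complex.exp (γ * y * Complex.I)‖ ≤ Real.exp (|β.im| * y) := by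
    intro γ hγ
    rw [Complex.norm_exp]
    refine Real.exp_le_exp.mpr ?_
    have h1 : (γ * y * Complex.I).re = -γ.im * y := by simp
    rw [h1]
    refine mul_le_mul_of_nonneg_right ?_ hy
    rcases hγ with h | h <;> rw [h]
    · exact neg_le_abs _
    · rw [neg_neg]; exact le_abs_self _
  have h1 := hle β (Or.inl rfl)
  have h2 := hle (-β) (Or.inr (by simp))
  rw [Complex.sin, norm_div, norm_mul, Complex.norm_I, mul_one, Complex.norm_ofNat,
    div_le_iff₀ (by norm_num)]
  rw [neg_mul] at h2
  linarith [norm_sub_le (Complex.exp (-(β * y) * Complex.I)) (Complex.exp (β * y * Complex.I))]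

theorem integrableOn_exp_abelPlana {c : ℝ} (hc : c < 2 * Real.pi) :
    IntegrableOn (fun y : ℝ ↦ Real.exp (c * y) * Real.exp (-(2 * Real.pi * y))) (Set.Ioi 0) := by
  have := integrableOn_exp_mul_Ioi (a := c - 2 * Real.pi) (by linarith) 0
  refine this.congr_fun (fun y _ ↦ ?_) measurableSet_Ioi
  simp only
  rw [← Real.exp_add]
  ring_nf

/-- Expansion of the kernel into exponentials, integrated against the sine. -/
theorem hasSum_integral_sin_mul_kernel {β : ℂ} (hβ : |β.im| < 2 * Real.pi)
    (hs : Summable fun n : ℕ ↦ (-1 : ℂ) ^ n * (β / (β ^ 2 + (2 * Real.pi * (n + 1)) ^ 2))) :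
    HasSum (fun n : ℕ ↦ (-1 : ℂ) ^ n * (β / (β ^ 2 + (2 * Real.pi * (n + 1)) ^ 2)))
      (∫ y : ℝ in Set.Ioi 0, Complex.sin (β * y) * abelPlanaKernel y) := by
  rw [hs.hasSum_iff_tendsto_nat]
  have hterm : ∀ n : ℕ, |β.im| < 2 * Real.pi * (n + 1) := fun n ↦
    hβ.trans_le (le_mul_of_one_le_right (by positivity) (by linarith [n.cast_nonneg (α := ℝ)]))
  -- The `M`-th partial sum of `∑ (-1)^n e^(-2π(n+1)y)` is the kernel times `1 - (-e^(-2πy))^M`.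
  -- This factor is at most `2` in absolute value, so dominated convergence applies to the partial
  -- sums.
  have hpart : ∀ M : ℕ, ∑ n ∈ Finset.range M,
      (-1 : ℂ) ^ n * (β / (β ^ 2 + (2 * Real.pi * (n + 1)) ^ 2)) =
      ∫ y : ℝ in Set.Ioi 0, Complex.sin (β * y) * (abelPlanaKernel y *
        (1 - (-Real.exp (-(2 * Real.pi * y))) ^ M) : ℝ) := by
    intro M
    have h1 : ∀ n : ℕ, (-1 : ℂ) ^ n * (β / (β ^ 2 + (2 * Real.pi * (n + 1)) ^ 2)) =
        ∫ y : ℝ in Set.Ioi 0, (-1 : ℂ) ^ n * (Complex.sin (β * y) *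
          Complex.exp (-((2 * Real.pi * (n + 1) : ℝ) * y))) := by
      intro n
      rw [integral_const_mul, (integral_sin_mul_exp_neg (hterm n)).2]
      push_cast
      rfl
    rw [Finset.sum_congr rfl fun n _ ↦ h1 n, ← integral_finsetSum]
    · refine setIntegral_congr_fun measurableSet_Ioi fun y _ ↦ ?_
      have h2 : abelPlanaKernel y * (1 - (-Real.exp (-(2 * Real.pi * y))) ^ M) =
          ∑ n ∈ Finset.range M, (-1) ^ n * Real.exp (-(2 * Real.pi * (n + 1) * y)) := by
        have h3 : ∀ n : ℕ, (-1) ^ n * Real.exp (-(2 * Real.pi * (n + 1) * y)) =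
            Real.exp (-(2 * Real.pi * y)) * (-Real.exp (-(2 * Real.pi * y))) ^ n := by
          intro n
          rw [neg_pow (Real.exp _), ← Real.exp_nat_mul, mul_left_comm, ← Real.exp_add]
          ring_nf
        rw [Finset.sum_congr rfl fun n _ ↦ h3 n, ← Finset.mul_sum, geom_sum_eq
          (by linarith [Real.exp_pos (-(2 * Real.pi * y))]), abelPlanaKernel, Real.exp_neg]
        have := Real.exp_pos (2 * Real.pi * y)
        generalize (-(Real.exp (2 * Real.pi * y))⁻¹) ^ M = P
        generalize Real.exp (2 * Real.pi * y) = E at this ⊢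
        rw [show -E⁻¹ - 1 = -((E + 1) / E) by field_simp; ring]
        field_simp
        ring
      rw [h2]
      push_cast
      rw [Finset.mul_sum]
      refine Finset.sum_congr rfl fun n _ ↦ ?_
      ring
    · intro n _
      exact (integral_sin_mul_exp_neg (hterm n)).1.const_mul _
  simp only [hpart]
  refine tendsto_integral_of_dominated_convergence (fun y ↦ 2 * (Real.exp (|β.im| * y) *
    Real.exp (-(2 * Real.pi * y)))) (fun M ↦ ?_) ((integrableOn_exp_abelPlana hβ).const_mul 2)
    (fun M ↦ ?_) ?_
  · refine Continuous.aestronglyMeasurable ?_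
    have := continuous_abelPlanaKernel
    fun_prop
  · refine (ae_restrict_iff' measurableSet_Ioi).mpr (Eventually.of_forall fun y hy ↦ ?_)
    have hy0 : (0 : ℝ) < y := hy
    have h1 := norm_sin_mul_le β hy0.le
    have h2 : |1 - (-Real.exp (-(2 * Real.pi * y))) ^ M| ≤ 2 := by
      have h3 : |(-Real.exp (-(2 * Real.pi * y))) ^ M| ≤ 1 := by
        rw [abs_pow, abs_neg, Real.abs_exp]
        refine pow_le_one₀ (Real.exp_pos _).le (Real.exp_le_one_iff.mpr ?_)
        have : 0 < 2 * Real.pi * y := by positivity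
        linarith
      have h4 := abs_sub (1 : ℝ) ((-Real.exp (-(2 * Real.pi * y))) ^ M)
      rw [abs_one] at h4
      linarith
    rw [norm_mul, Complex.norm_real, Real.norm_eq_abs, abs_mul, abs_of_pos (abelPlanaKernel_pos y)]
    calc _ ≤ Real.exp (|β.im| * y) * (Real.exp (-(2 * Real.pi * y)) * 2) := by
          have := (abelPlanaKernel_pos y).le
          gcongr
          exact abelPlanaKernel_le y
      _ = _ := by ring
  · refine (ae_restrict_iff' measurableSet_Ioi).mpr (Eventually.of_forall fun y hy ↦ ?_)
    have hy0 : (0 : ℝ) < y := hy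
    have h1 : Tendsto (fun M : ℕ ↦ (-Real.exp (-(2 * Real.pi * y))) ^ M) atTop (𝓝 0) := by
      refine tendsto_pow_atTop_nhds_zero_of_abs_lt_one ?_
      rw [abs_neg, Real.abs_exp, Real.exp_lt_one_iff]
      have : 0 < 2 * Real.pi * y := by positivity
      linarith
    have h2 := (h1.const_sub 1).const_mul (abelPlanaKernel y)
    rw [sub_zero, mul_one] at h2
    exact ((Complex.continuous_ofReal.tendsto _).comp h2).const_mul _

theorem cexp_ne_one_of_abs_im_lt {β : ℂ} (h0 : β ≠ 0) (hβ : |β.im| < 2 * Real.pi) :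
    Complex.exp β ≠ 1 := by
  intro h
  obtain ⟨m, hm⟩ := Complex.exp_eq_one_iff.mp h
  have h1 : β.im = m * (2 * Real.pi) := by rw [hm]; simp
  have h2 : m = 0 := by
    rw [h1, abs_mul, abs_of_pos Real.two_pi_pos] at hβ
    have h3 : |(m : ℝ)| < 1 := by
      have := Real.two_pi_pos
      nlinarith
    exact Int.abs_lt_one_iff.mp (by exact_mod_cast h3)
  rw [h2] at hm
  exact h0 (by simpa using hm)

theorem sinh_half_ne_zero {β : ℂ} (h0 : β ≠ 0) (hβ : |β.im| < 2 * Real.pi) :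
    Complex.sinh (β / 2) ≠ 0 := by
  intro h
  refine cexp_ne_one_of_abs_im_lt h0 hβ ?_
  rw [Complex.sinh, div_eq_zero_iff, or_iff_left (by norm_num), sub_eq_zero] at h
  rw [show β = β / 2 + β / 2 by ring, Complex.exp_add]
  nth_rw 2 [h]
  rw [← Complex.exp_add, add_neg_cancel, Complex.exp_zero]

/-- The partial fraction expansion of the hyperbolic cotangent. -/
theorem hasSum_coth {β : ℂ} (h0 : β ≠ 0) (hβ : |β.im| < 2 * Real.pi) :
    HasSum (fun n : ℕ ↦ β / (β ^ 2 + (2 * Real.pi * (n + 1)) ^ 2))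
      (Complex.cosh (β / 2) / Complex.sinh (β / 2) / 4 - 1 / (2 * β)) := by
  have hpi : (Real.pi : ℂ) ≠ 0 := by exact_mod_cast Real.pi_ne_zero
  -- This substitution turns the partial fractions of `π cot(πx)` into those of `coth(β/2)`. The
  -- strip `|Im β| < 2π` without `0` misses the integers.
  set x : ℂ := β * Complex.I / (2 * Real.pi) with hx
  have hxβ : β = -(2 * Real.pi * x * Complex.I) := by
    rw [hx]
    field_simp
    linear_combination Complex.I_sq
  have hxmem : x ∈ Complex.integerComplement := by
    rw [Complex.mem_integerComplement_iff]
    rintro ⟨n, hn⟩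
    refine cexp_ne_one_of_abs_im_lt h0 hβ ?_
    rw [Complex.exp_eq_one_iff]
    exact ⟨-n, by rw [hxβ, ← hn]; push_cast; ring⟩
  have hsum := (summable_cotTerm hxmem).hasSum
  have hval : ∑' n : ℕ, cotTerm x n = Real.pi * Complex.cot (Real.pi * x) - 1 / x := by
    rw [cot_series_rep' hxmem]
  rw [hval] at hsum
  have hcot : Complex.cot (Real.pi * x) =
      -Complex.I * (Complex.cosh (β / 2) / Complex.sinh (β / 2)) := by
    rw [show (Real.pi : ℂ) * x = β / 2 * Complex.I by rw [hx]; field_simp, Complex.cot,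
      Complex.cos_mul_I, Complex.sin_mul_I]
    have := sinh_half_ne_zero h0 hβ
    field_simp
    linear_combination Complex.cosh (β / 2) * Complex.I_sq
  have h1 := hsum.mul_left (Complex.I / (4 * Real.pi))
  have hval2 : Complex.I / (4 * Real.pi) * (Real.pi * Complex.cot (Real.pi * x) - 1 / x) =
      Complex.cosh (β / 2) / Complex.sinh (β / 2) / 4 - 1 / (2 * β) := by
    have := sinh_half_ne_zero h0 hβ
    rw [hcot, hx]
    field_simp
    linear_combination (-2 * β * Complex.cosh (β / 2)) * Complex.I_sq
  rw [hval2] at h1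
  refine h1.congr_fun fun n ↦ ?_
  have hn1 : x + (n + 1) ≠ 0 := by
    exact_mod_cast Complex.integerComplement_add_ne_zero hxmem (n + 1 : ℤ)
  have hn2 : x - (n + 1) ≠ 0 := by
    have := Complex.integerComplement_add_ne_zero hxmem (-(n + 1) : ℤ)
    push_cast at this
    rwa [← sub_eq_add_neg] at this
  have hden : β ^ 2 + (2 * Real.pi * ((n : ℂ) + 1)) ^ 2 =
      -(4 * Real.pi ^ 2) * ((x + (n + 1)) * (x - (n + 1))) := by
    rw [hxβ]
    linear_combination (4 * Real.pi ^ 2 * x ^ 2) * Complex.I_sq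
  rw [hden, cotTerm]
  nth_rw 1 [hxβ]
  field_simp
  ring

/-- Legendre's integral in its alternating form. -/
theorem integral_sin_mul_abelPlanaKernel {β : ℂ} (h0 : β ≠ 0) (hβ : |β.im| < 2 * Real.pi) :
    ∫ y : ℝ in Set.Ioi 0, Complex.sin (β * y) * abelPlanaKernel y =
      1 / (2 * β) - 1 / (4 * Complex.sinh (β / 2)) := by
  have h02 : β / 2 ≠ 0 := div_ne_zero h0 two_ne_zero
  have hβ2 : |(β / 2).im| < 2 * Real.pi := by
    rw [Complex.div_ofNat_im, abs_div, abs_two]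
    linarith [abs_nonneg β.im]
  have hA := hasSum_coth h0 hβ
  have hB := hasSum_coth h02 hβ2
  set h : ℕ → ℂ := fun n ↦ β / (β ^ 2 + (2 * Real.pi * (n + 1)) ^ 2) with hh
  -- The alternating sum is the full sum minus twice its odd-indexed part, and the doubled odd part
  -- for `β` is the full sum for `β/2`. What remains is `coth(β/2) - coth(β/4) = -1/sinh(β/2)`.
  have hodd : ∀ n : ℕ, 2 * h (2 * n + 1) =
      (β / 2) / ((β / 2) ^ 2 + (2 * Real.pi * (n + 1)) ^ 2) := by
    intro n
    have : β ^ 2 + (2 * Real.pi * (((2 * n + 1 : ℕ) : ℂ) + 1)) ^ 2 =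
        4 * ((β / 2) ^ 2 + (2 * Real.pi * (n + 1)) ^ 2) := by
      push_cast
      ring
    rw [hh]
    simp only
    rw [this, mul_comm (4 : ℂ), ← div_div]
    ring
  have hg : HasSum (fun n : ℕ ↦ if Even n then 0 else 2 * h n)
      (0 + (Complex.cosh (β / 2 / 2) / Complex.sinh (β / 2 / 2) / 4 - 1 / (2 * (β / 2)))) := by
    refine HasSum.even_add_odd ?_ ?_
    · simp
    · simp only [Nat.not_even_bit1, if_false, hodd]
      exact hB
  have halt := (hA.sub hg).congr_fun (g := fun n : ℕ ↦ (-1 : ℂ) ^ n * h n) fun n ↦ by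
    split_ifs with hn
    · rw [hn.neg_one_pow]; simp [hh]
    · rw [(Nat.not_even_iff_odd.mp hn).neg_one_pow]; simp only [hh]; ring
  rw [(hasSum_integral_sin_mul_kernel hβ halt.summable).unique halt]
  have s1 := sinh_half_ne_zero h0 hβ
  have s2 := sinh_half_ne_zero h02 hβ2
  have e1 : Complex.sinh (β / 2) = 2 * Complex.sinh (β / 2 / 2) * Complex.cosh (β / 2 / 2) := by
    rw [← Complex.sinh_two_mul]; ring_nf
  have e2 : Complex.cosh (β / 2) = 2 * Complex.cosh (β / 2 / 2) ^ 2 - 1 := by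
    have h1 := Complex.cosh_two_mul (β / 2 / 2)
    have h2 := Complex.cosh_sq_sub_sinh_sq (β / 2 / 2)
    rw [show 2 * (β / 2 / 2) = β / 2 by ring] at h1
    linear_combination h1 - h2
  have s3 : Complex.cosh (β / 2 / 2) ≠ 0 := fun h ↦ s1 (by rw [e1, h, mul_zero])
  rw [e2, e1]
  generalize Complex.cosh (β / 2 / 2) = u at *
  generalize Complex.sinh (β / 2 / 2) = v at *
  field_simp
  ring

/-! ### The Abel–Plana formula for the expansion of `g_q` -/

section

variable {q a : ℝ}

theorem ofReal_cpow_eq_exp (hq0 : 0 < q) (z : ℂ) :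
    (q : ℂ) ^ z = Complex.exp ((Real.log q : ℂ) * z) := by
  rw [Complex.cpow_def_of_ne_zero (by exact_mod_cast hq0.ne'), Complex.ofReal_log hq0.le]

/-- The Abel–Plana formula for the exponential function `z ↦ q ^ (z w)`. -/
theorem qGeom_eq_abelPlana (hq0 : 0 < q) (hq1 : q < 1) (a : ℝ) {w : ℂ} (hw : w ≠ 0)
    (him : |Real.log q * w.im| < 2 * Real.pi) :
    qGeom q a w = (q : ℂ) ^ ((a : ℂ) * w) +
      (q : ℂ) ^ ((a + 1 / 2 : ℝ) * w) / (-(Real.log q : ℂ) * w) -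
      Complex.I * ∫ y : ℝ in Set.Ioi 0, abelPlanaKernel y *
        ((q : ℂ) ^ (((a + 1 / 2 : ℝ) + y * Complex.I) * w) -
          (q : ℂ) ^ (((a + 1 / 2 : ℝ) - y * Complex.I) * w)) := by
  have hl : (Real.log q : ℂ) ≠ 0 := by exact_mod_cast (Real.log_neg hq0 hq1).ne
  set β : ℂ := -(Real.log q : ℂ) * w with hβ
  have hβ0 : β ≠ 0 := mul_ne_zero (neg_ne_zero.mpr hl) hw
  have hβim : |β.im| < 2 * Real.pi := by
    rw [hβ, ← Complex.ofReal_neg, Complex.im_ofReal_mul, neg_mul, abs_neg]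
    exact him
  set P : ℂ := (q : ℂ) ^ ((a + 1 / 2 : ℝ) * w) with hP
  -- With `β = -w log q`, `q^(iyw) - q^(-iyw) = -2i sin(βy)`, which reduces the claim to Legendre's
  -- integral.
  have hint : ∀ y : ℝ, (abelPlanaKernel y : ℂ) *
        ((q : ℂ) ^ (((a + 1 / 2 : ℝ) + y * Complex.I) * w) -
          (q : ℂ) ^ (((a + 1 / 2 : ℝ) - y * Complex.I) * w)) =
      (-2 * Complex.I * P) * (Complex.sin (β * y) * abelPlanaKernel y) := by
    intro y
    rw [add_mul, sub_mul, sub_eq_add_neg _ (y * Complex.I * w), ofReal_cpow_add hq0,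
      ofReal_cpow_add hq0, ← hP, ofReal_cpow_eq_exp hq0 (y * Complex.I * w),
      ofReal_cpow_eq_exp hq0 (-(y * Complex.I * w)), Complex.sin,
      show (Real.log q : ℂ) * (y * Complex.I * w) = -(β * y) * Complex.I by rw [hβ]; ring,
      show (Real.log q : ℂ) * -(y * Complex.I * w) = (β * y) * Complex.I by rw [hβ]; ring]
    linear_combination ((abelPlanaKernel y : ℂ) * P * (Complex.exp (-(β * y) * Complex.I) -
      Complex.exp (β * y * Complex.I))) * Complex.I_sq
  simp only [hint]
  rw [integral_const_mul, integral_sin_mul_abelPlanaKernel hβ0 hβim, qGeom]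
  have hE : (q : ℂ) ^ w = Complex.exp (-(β / 2)) * Complex.exp (-(β / 2)) := by
    rw [ofReal_cpow_eq_exp hq0, ← Complex.exp_add, hβ]
    ring_nf
  have hPE : P = (q : ℂ) ^ ((a : ℂ) * w) * Complex.exp (-(β / 2)) := by
    rw [hP, ofReal_cpow_eq_exp hq0, ofReal_cpow_eq_exp hq0, ← Complex.exp_add, hβ]
    push_cast
    ring_nf
  have hs : 2 * Complex.sinh (β / 2) * Complex.exp (-(β / 2)) = 1 - (q : ℂ) ^ w := by
    rw [hE, Complex.sinh]
    have : Complex.exp (β / 2) * Complex.exp (-(β / 2)) = 1 := by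
      rw [← Complex.exp_add, add_neg_cancel, Complex.exp_zero]
    linear_combination this
  have s1 := sinh_half_ne_zero hβ0 hβim
  have e1 : Complex.exp (-(β / 2)) ≠ 0 := Complex.exp_ne_zero _
  rw [hPE, ← hs]
  have hs' : 2 * Complex.sinh (β / 2) * Complex.exp (-(β / 2)) =
    1 - Complex.exp (-(β / 2)) * Complex.exp (-(β / 2)) := by rw [hs, hE]
  generalize Complex.exp (-(β / 2)) = e at *
  generalize Complex.sinh (β / 2) = σ at *
  generalize (q : ℂ) ^ ((a : ℂ) * w) = A at *
  clear_value β
  rw [show ∀ X : ℂ, Complex.I * (-2 * Complex.I * (A * e) * X) = 2 * (A * e) * X by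
    intro X; linear_combination (-2 * A * e * X) * Complex.I_sq]
  field_simp
  linear_combination (-4 * A * β) * hs'

/-- The summand of the Abel–Plana formula for `g_q(s, t, a)`, up to a power of `1 - q`. -/
noncomputable def qSummand (q : ℝ) (s t z : ℂ) : ℂ := (q : ℂ) ^ (z * t) * (1 - (q : ℂ) ^ z) ^ (-s)

theorem norm_cpow_vertical_le (hq0 : 0 < q) (b : ℝ) {y : ℝ} (hy : 0 ≤ y) {z w : ℂ}
    (hz : z = b + y * Complex.I ∨ z = b - y * Complex.I) :
    ‖(q : ℂ) ^ (z * w)‖ ≤ q ^ (b * w.re) * Real.exp (|Real.log q * w.im| * y) := by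
  rw [Complex.norm_cpow_eq_rpow_re_of_pos hq0, Real.rpow_def_of_pos hq0, Real.rpow_def_of_pos hq0,
    ← Real.exp_add]
  refine Real.exp_le_exp.mpr ?_
  rcases hz with rfl | rfl
  · have : (((b : ℂ) + y * Complex.I) * w).re = b * w.re - y * w.im := by simp
    rw [this]
    nlinarith [neg_abs_le (Real.log q * w.im)]
  · have : (((b : ℂ) - y * Complex.I) * w).re = b * w.re + y * w.im := by simp
    rw [this]
    nlinarith [le_abs_self (Real.log q * w.im)]

/-- The Abel–Plana formula for `∑ c_r(s) q ^ (a (t + r)) / (1 - q ^ (t + r))`. -/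
theorem tsum_qGeom_eq_abelPlana (hq0 : 0 < q) (hq1 : q < 1) (ha : 0 < a) (s : ℂ) {t : ℂ}
    (ht : ∀ r : ℕ, t + r ≠ 0) (him : |Real.log q * t.im| < 2 * Real.pi) {S : ℂ}
    (hS : HasSum (fun r : ℕ ↦ risingCoeff s r * ((q : ℂ) ^ ((a + 1 / 2 : ℝ) * (t + r)) / (t + r)))
      S) :
    ∑' r : ℕ, risingCoeff s r * qGeom q a (t + r) =
      qSummand q s t a + S / (-(Real.log q : ℂ)) -
      Complex.I * ∫ y : ℝ in Set.Ioi 0, abelPlanaKernel y *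
        (qSummand q s t ((a + 1 / 2 : ℝ) + y * Complex.I) -
          qSummand q s t ((a + 1 / 2 : ℝ) - y * Complex.I)) := by
  set b : ℝ := a + 1 / 2 with hb
  have hb0 : 0 < b := by positivity
  set F : ℕ → ℝ → ℂ := fun r y ↦ abelPlanaKernel y *
    (risingCoeff s r * (q : ℂ) ^ (((b : ℂ) + y * Complex.I) * (t + r)) -
      risingCoeff s r * (q : ℂ) ^ (((b : ℂ) - y * Complex.I) * (t + r))) with hF
  have hq : (q : ℂ) ≠ 0 := by exact_mod_cast hq0.ne'
  obtain ⟨N, hN⟩ := exists_norm_le_natCast_add_one s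
  set g : ℝ → ℝ := fun y ↦ Real.exp (|Real.log q * t.im| * y) * Real.exp (-(2 * Real.pi * y))
  have hg : IntegrableOn g (Set.Ioi 0) := integrableOn_exp_abelPlana him
  have hFle : ∀ r : ℕ, ∀ y ∈ Set.Ioi (0 : ℝ), ‖F r y‖ ≤
      ((r + N).choose N * (q ^ b) ^ r * (2 * q ^ (b * t.re))) * g y := by
    intro r y hy
    have h1 := norm_cpow_vertical_le hq0 b (le_of_lt hy) (w := t + r) (Or.inl rfl)
    have h2 := norm_cpow_vertical_le hq0 b (le_of_lt hy) (w := t + r) (Or.inr rfl)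
    have h3 : q ^ (b * (t + (r : ℂ)).re) = (q ^ b) ^ r * q ^ (b * t.re) := by
      rw [← Real.rpow_natCast, ← Real.rpow_mul hq0.le, ← Real.rpow_add hq0]
      simp only [Complex.add_re, Complex.natCast_re]
      ring_nf
    -- The imaginary part of `t + r` does not depend on `r`, so a single exponential in `y`
    -- dominates all terms and one condition on `q` suffices.
    simp only [Complex.add_im, Complex.natCast_im, add_zero, h3] at h1 h2
    have h4 := (norm_sub_le ((q : ℂ) ^ (((b : ℂ) + y * Complex.I) * (t + r)))
      ((q : ℂ) ^ (((b : ℂ) - y * Complex.I) * (t + r)))).trans (add_le_add h1 h2)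
    rw [hF]
    simp only
    rw [← mul_sub, norm_mul, norm_mul, Complex.norm_real, Real.norm_eq_abs,
      abs_of_pos (abelPlanaKernel_pos y)]
    calc _ ≤ Real.exp (-(2 * Real.pi * y)) * ((r + N).choose N * _) := by
          refine mul_le_mul (abelPlanaKernel_le y) ?_ (by positivity) (by positivity)
          exact mul_le_mul (norm_risingCoeff_le hN r) h4 (norm_nonneg _) (by positivity)
      _ = _ := by ring
  have hFcont : ∀ r, Continuous (F r) := by
    intro r
    have := continuous_abelPlanaKernel
    simp only [hF, ofReal_cpow_eq_exp hq0]
    fun_prop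
  have hFint : ∀ r, Integrable (F r) (volume.restrict (Set.Ioi 0)) := fun r ↦
    (hg.const_mul _).mono' (hFcont r).aestronglyMeasurable
      ((ae_restrict_iff' measurableSet_Ioi).mpr (Eventually.of_forall (hFle r)))
  have hFsum : Summable fun r ↦ ∫ y in Set.Ioi 0, ‖F r y‖ := by
    refine ((summable_majorant hq0 hq1 hb0 N (2 * q ^ (b * t.re))).mul_right
      (∫ y in Set.Ioi 0, g y)).of_nonneg_of_le
      (fun r ↦ integral_nonneg fun y ↦ norm_nonneg _) fun r ↦ ?_
    rw [← integral_const_mul]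
    exact setIntegral_mono_on (hFint r).norm (hg.const_mul _) measurableSet_Ioi (hFle r)
  have hsum1 := hasSum_integral_of_summable_integral_norm hFint hFsum
  have hpt : ∀ y ∈ Set.Ioi (0 : ℝ), ∑' r, F r y = abelPlanaKernel y *
      (qSummand q s t (b + y * Complex.I) - qSummand q s t (b - y * Complex.I)) := by
    intro y _
    exact (((hasSum_risingCoeff_mul_cpow hq0 hq1 s t (by simpa using hb0)).sub
      (hasSum_risingCoeff_mul_cpow hq0 hq1 s t (by simpa using hb0))).mul_left _).tsum_eq
  rw [setIntegral_congr_fun measurableSet_Ioi hpt] at hsum1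
  have hsum0 := hasSum_risingCoeff_mul_cpow hq0 hq1 s t (z := a) (by simpa using ha)
  have htot := (hsum0.add (hS.div_const (-(Real.log q : ℂ)))).sub (hsum1.mul_left Complex.I)
  refine HasSum.tsum_eq (htot.congr_fun fun r ↦ ?_)
  rw [qGeom_eq_abelPlana hq0 hq1 a (ht r) (by simpa using him)]
  have hint : ∫ y in Set.Ioi 0, F r y = risingCoeff s r * ∫ y : ℝ in Set.Ioi 0,
      abelPlanaKernel y * ((q : ℂ) ^ (((b : ℂ) + y * Complex.I) * (t + r)) -
      (q : ℂ) ^ (((b : ℂ) - y * Complex.I) * (t + r))) := by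
    rw [← integral_const_mul]
    refine integral_congr_ae (Eventually.of_forall fun y ↦ ?_)
    simp only [hF]
    ring
  rw [hint, mul_comm (-(Real.log q : ℂ)), ← div_div]
  ring

/-- This is where `t = s - 1` is special: `c_r(s)/(s-1+r) = c_r(s-1)/(s-1)`, so the integrated
binomial series is again a binomial series. Analytically, the main term has an elementary
antiderivative. -/
theorem hasSum_risingCoeff_mul_cpow_div (hq0 : 0 < q) (hq1 : q < 1) {b : ℝ} (hb : 0 < b) {s : ℂ}
    (hs : ∀ r : ℕ, s - 1 + r ≠ 0) :
    HasSum (fun r : ℕ ↦ risingCoeff s r * ((q : ℂ) ^ (b * (s - 1 + r)) / (s - 1 + r)))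
      (qSummand q (s - 1) (s - 1) b / (s - 1)) := by
  have h := (hasSum_risingCoeff_mul_cpow hq0 hq1 (s - 1) (s - 1) (z := b)
    (by simpa using hb)).div_const (s - 1)
  refine h.congr_fun fun r ↦ ?_
  have h0 : s - 1 ≠ 0 := by simpa using hs 0
  have key : risingCoeff s r / (s - 1 + r) = risingCoeff (s - 1) r / (s - 1) := by
    cases r with
    | zero => simp [risingCoeff_zero]
    | succ r =>
      have h1 := hs (r + 1)
      have h2 : (r : ℂ) + 1 ≠ 0 := by exact_mod_cast r.succ_ne_zero
      rw [risingCoeff_succ, risingCoeff_sub_one_succ]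
      push_cast at h1 ⊢
      rw [show s - 1 + (r + 1) = s + r by ring] at h1 ⊢
      field_simp
  rw [← mul_div_assoc, mul_div_right_comm, key]
  ring

end

/-! ### Holomorphy and limits of Abel–Plana integrals -/

/-- A parameter integral of holomorphic functions with an integrable majorant is differentiable. -/
theorem differentiableAt_integral_of_norm_le {α : Type*} [MeasurableSpace α] {μ : Measure α}
    {F : ℂ → α → ℂ} {s₀ : ℂ} {R : ℝ} (hR : 0 < R) {g : α → ℝ} (hg : Integrable g μ)
    (hm : ∀ s ∈ Metric.ball s₀ R, AEStronglyMeasurable (F s) μ)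
    (hd : ∀ᵐ y ∂μ, DifferentiableOn ℂ (fun s ↦ F s y) (Metric.ball s₀ R))
    (hb : ∀ᵐ y ∂μ, ∀ s ∈ Metric.ball s₀ R, ‖F s y‖ ≤ g y) :
    DifferentiableAt ℂ (fun s ↦ ∫ y, F s y ∂μ) s₀ := by
  have hda : ∀ᵐ y ∂μ, ∀ s ∈ Metric.ball s₀ R, HasDerivAt (fun s ↦ F s y)
      (deriv (fun s ↦ F s y) s) s := by
    filter_upwards [hd] with y hy s hs
    exact (hy.differentiableAt (Metric.isOpen_ball.mem_nhds hs)).hasDerivAt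
  have hmem0 := Metric.mem_ball_self (x := s₀) hR
  -- The derivative at the centre is a limit of difference quotients along a fixed sequence of
  -- steps, hence measurable in `y`.
  have hmeas : AEStronglyMeasurable (fun y ↦ deriv (fun s ↦ F s y) s₀) μ := by
    have hseq : Tendsto (fun n : ℕ ↦ ((R / 2 / ((n : ℝ) + 1) : ℝ) : ℂ)) atTop (𝓝[≠] 0) := by
      refine tendsto_nhdsWithin_iff.mpr ⟨?_, Eventually.of_forall fun n ↦ ?_⟩
      · have h1 : Tendsto (fun n : ℕ ↦ R / 2 / ((n : ℝ) + 1)) atTop (𝓝 0) := by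
          have := tendsto_one_div_add_atTop_nhds_zero_nat (𝕜 := ℝ)
          simpa [div_eq_mul_inv] using this.const_mul (R / 2)
        have h2 := (Complex.continuous_ofReal.tendsto 0).comp h1
        rwa [Complex.ofReal_zero] at h2
      · have : R / 2 / ((n : ℝ) + 1) ≠ 0 := by positivity
        exact Complex.ofReal_ne_zero.mpr this
    refine aestronglyMeasurable_of_tendsto_ae atTop (f := fun (n : ℕ) y ↦
      (((R / 2 / ((n : ℝ) + 1) : ℝ) : ℂ))⁻¹ • (F (s₀ + ((R / 2 / ((n : ℝ) + 1) : ℝ) : ℂ)) y - F s₀ y))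
      (fun n ↦ ?_) ?_
    · have h1 : s₀ + ((R / 2 / ((n : ℝ) + 1) : ℝ) : ℂ) ∈ Metric.ball s₀ R := by
        rw [mem_ball_iff_norm, add_sub_cancel_left, Complex.norm_real, Real.norm_of_nonneg
          (by positivity)]
        calc R / 2 / ((n : ℝ) + 1) ≤ R / 2 := div_le_self (by positivity)
              (by linarith [n.cast_nonneg (α := ℝ)])
          _ < R := by linarith
      exact ((hm _ h1).sub (hm _ hmem0)).const_smul (((R / 2 / ((n : ℝ) + 1) : ℝ) : ℂ))⁻¹
    · filter_upwards [hda] with y hy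
      exact (hasDerivAt_iff_tendsto_slope_zero.mp (hy s₀ hmem0)).comp hseq
  have hball : Metric.ball s₀ (R / 2) ⊆ Metric.ball s₀ R := Metric.ball_subset_ball (by linarith)
  refine (hasDerivAt_integral_of_dominated_loc_of_deriv_le (F := F)
    (F' := fun s y ↦ deriv (fun s ↦ F s y) s) (bound := fun y ↦ g y / (R / 4))
    (Metric.ball_mem_nhds s₀ (half_pos hR)) ?_ ?_ hmeas ?_ (hg.div_const _) ?_).2.differentiableAt
  · filter_upwards [Metric.ball_mem_nhds s₀ hR] with s hs using hm s hs
  · exact hg.mono' (hm _ hmem0) (hb.mono fun y hy ↦ hy _ hmem0)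
  · filter_upwards [hd, hb] with y hy1 hy2 s hs
    -- Cauchy's estimate on this disc gives the majorant `g / (R / 4)` for the derivative.
    have hsub : Metric.closedBall s (R / 4) ⊆ Metric.ball s₀ R := by
      refine Metric.closedBall_subset_ball' ?_
      rw [Metric.mem_ball] at hs
      linarith
    refine Complex.norm_deriv_le_of_forall_mem_sphere_norm_le (by positivity)
      (DifferentiableOn.diffContOnCl ?_)
      fun z hz ↦ hy2 z (hsub (Metric.sphere_subset_closedBall hz))
    rw [closure_ball _ (by positivity)]
    exact hy1.mono hsub
  · filter_upwards [hda] with y hy s hs using hy s (hball hs)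

/-- The integral `∫ (f (b + i y) - f (b - i y)) / (e ^ (2 π y) + 1)` of the midpoint form of the
Abel–Plana formula. -/
noncomputable def abelPlanaIntegral (f : ℂ → ℂ) (b : ℝ) : ℂ :=
  ∫ y : ℝ in Set.Ioi 0, abelPlanaKernel y * (f (b + y * Complex.I) - f (b - y * Complex.I))

/-- The half plane of all `z` with real part at least `1 / 2`, cut off at height about `y`. -/
def halfStrip (y : ℝ) : Set ℂ := {z | 1 / 2 ≤ z.re ∧ ‖z‖ ≤ 2 * (1 + y)}

theorem mem_halfStrip {b : ℝ} (hb0 : 1 / 2 ≤ b) (hb1 : b ≤ 3 / 2) {y : ℝ} (hy : 0 ≤ y) :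
    (b : ℂ) + y * Complex.I ∈ halfStrip y ∧ (b : ℂ) - y * Complex.I ∈ halfStrip y := by
  have h1 : ‖(b : ℂ)‖ + ‖y * Complex.I‖ ≤ 2 * (1 + y) := by
    rw [norm_mul, Complex.norm_I, Complex.norm_real, Complex.norm_real, Real.norm_of_nonneg hy,
      Real.norm_of_nonneg (by linarith)]
    linarith
  refine ⟨⟨by simpa using hb0, (norm_add_le _ _).trans h1⟩,
    ⟨by simpa using hb0, (norm_sub_le _ _).trans h1⟩⟩

theorem integrable_exp_neg_Ioi (C : ℝ) :
    IntegrableOn (fun y : ℝ ↦ C * Real.exp (-y)) (Set.Ioi 0) := by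
  have := (integrableOn_exp_mul_Ioi (a := -1) (by norm_num) 0).const_mul C
  simpa [IntegrableOn] using this

/-- The kernel is at most `e^(-2πy) ≤ e^(-3y)`, which beats growth `e^(2y)` and leaves an integrable
`e^(-y)`. Hence the exponent `2y` in all the bounds on `f`. -/
theorem norm_abelPlana_integrand_le {f : ℂ → ℂ} {b : ℝ} (hb0 : 1 / 2 ≤ b) (hb1 : b ≤ 3 / 2)
    {C y : ℝ} (hy : 0 ≤ y) (hf : ∀ z ∈ halfStrip y, ‖f z‖ ≤ C * Real.exp (2 * y)) :
    ‖abelPlanaKernel y * (f (b + y * Complex.I) - f (b - y * Complex.I))‖ ≤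
      2 * C * Real.exp (-y) := by
  obtain ⟨h1, h2⟩ := mem_halfStrip hb0 hb1 hy
  have h3 := (norm_sub_le (f (b + y * Complex.I)) (f (b - y * Complex.I))).trans
    (add_le_add (hf _ h1) (hf _ h2))
  have hC : 0 ≤ C * Real.exp (2 * y) := (norm_nonneg _).trans (hf _ h1)
  rw [norm_mul, Complex.norm_real, Real.norm_of_nonneg (abelPlanaKernel_pos y).le]
  calc _ ≤ Real.exp (-(2 * Real.pi * y)) * (C * Real.exp (2 * y) + C * Real.exp (2 * y)) :=
        mul_le_mul (abelPlanaKernel_le y) h3 (norm_nonneg _) (Real.exp_pos _).le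
    _ ≤ Real.exp (-(3 * y)) * (C * Real.exp (2 * y) + C * Real.exp (2 * y)) := by
        gcongr
        nlinarith [Real.pi_gt_three]
    _ = _ := by
        have : Real.exp (-y) = Real.exp (-(3 * y)) * Real.exp (2 * y) := by
          rw [← Real.exp_add]; ring_nf
        rw [this]; ring

theorem continuous_abelPlana_integrand {f : ℂ → ℂ} {b : ℝ} (hb0 : 0 < b)
    (hf : ∀ z : ℂ, 0 < z.re → ContinuousAt f z) :
    Continuous fun y : ℝ ↦
      (abelPlanaKernel y : ℂ) * (f (b + y * Complex.I) - f (b - y * Complex.I)) := by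
  refine (Complex.continuous_ofReal.comp continuous_abelPlanaKernel).mul ?_
  rw [continuous_iff_continuousAt]
  intro y
  refine ContinuousAt.sub ?_ ?_
  · exact ContinuousAt.comp (f := fun y : ℝ ↦ (b : ℂ) + y * Complex.I)
      (hf _ (by simpa using hb0)) (by fun_prop)
  · exact ContinuousAt.comp (f := fun y : ℝ ↦ (b : ℂ) - y * Complex.I)
      (hf _ (by simpa using hb0)) (by fun_prop)

theorem differentiableAt_abelPlanaIntegral {f : ℂ → ℂ → ℂ} {s₀ : ℂ} {R : ℝ} (hR : 0 < R)
    {b : ℝ} (hb0 : 1 / 2 ≤ b) (hb1 : b ≤ 3 / 2) (C : ℝ)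
    (hc : ∀ s, ∀ z : ℂ, 0 < z.re → ContinuousAt (f s) z)
    (hd : ∀ z : ℂ, 0 < z.re → Differentiable ℂ fun s ↦ f s z)
    (hf : ∀ s ∈ Metric.ball s₀ R, ∀ y : ℝ, 0 ≤ y → ∀ z ∈ halfStrip y,
      ‖f s z‖ ≤ C * Real.exp (2 * y)) :
    DifferentiableAt ℂ (fun s ↦ abelPlanaIntegral (f s) b) s₀ := by
  refine differentiableAt_integral_of_norm_le hR (integrable_exp_neg_Ioi (2 * C)) ?_ ?_ ?_
  · exact fun s _ ↦ (continuous_abelPlana_integrand (by linarith) (hc s)).aestronglyMeasurable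
  · refine Eventually.of_forall fun y ↦ Differentiable.differentiableOn ?_
    exact ((hd _ (by simp; linarith)).sub (hd _ (by simp; linarith))).const_mul _
  · refine (ae_restrict_iff' measurableSet_Ioi).mpr (Eventually.of_forall fun y hy s hs ↦ ?_)
    exact norm_abelPlana_integrand_le hb0 hb1 (le_of_lt hy) (hf s hs y (le_of_lt hy))

theorem tendsto_abelPlanaIntegral {ι : Type*} {l : Filter ι} [l.IsCountablyGenerated]
    {f : ι → ℂ → ℂ} {f₀ : ℂ → ℂ} {b : ℝ} (hb0 : 1 / 2 ≤ b) (hb1 : b ≤ 3 / 2) (C : ℝ)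
    (hc : ∀ᶠ i in l, ∀ z : ℂ, 0 < z.re → ContinuousAt (f i) z)
    (hf : ∀ᶠ i in l, ∀ y : ℝ, 0 ≤ y → ∀ z ∈ halfStrip y, ‖f i z‖ ≤ C * Real.exp (2 * y))
    (hlim : ∀ z : ℂ, 0 < z.re → Tendsto (fun i ↦ f i z) l (𝓝 (f₀ z))) :
    Tendsto (fun i ↦ abelPlanaIntegral (f i) b) l (𝓝 (abelPlanaIntegral f₀ b)) := by
  refine tendsto_integral_filter_of_dominated_convergence _ ?_ ?_
    (integrable_exp_neg_Ioi (2 * C)) ?_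
  · filter_upwards [hc] with i hi using
      (continuous_abelPlana_integrand (by linarith) hi).aestronglyMeasurable
  · filter_upwards [hf] with i hi
    refine (ae_restrict_iff' measurableSet_Ioi).mpr (Eventually.of_forall fun y hy ↦ ?_)
    exact norm_abelPlana_integrand_le hb0 hb1 (le_of_lt hy) (hi y (le_of_lt hy))
  · refine Eventually.of_forall fun y ↦ Tendsto.const_mul _ ((hlim _ ?_).sub (hlim _ ?_)) <;>
    · simp; linarith

/-- `|W^(-s)| = |W|^(-Re s) e^(arg W · Im s)`. The lower bound on `|W|` controls negative powers,
and `(1+y)^N ≤ N! e^(1+y)` trades polynomial growth for `e^y`. -/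
theorem norm_cpow_neg_le_mul_exp {W s : ℂ} {N : ℕ} {y : ℝ} (hy : 0 ≤ y) (hs : ‖s‖ ≤ N)
    (h1 : 1 / 2 ≤ ‖W‖) (h2 : ‖W‖ ≤ 8 * (1 + y)) :
    ‖W ^ (-s)‖ ≤ 8 ^ N * N.factorial * Real.exp 1 * Real.exp (Real.pi * N) * Real.exp y := by
  have hre := (Complex.abs_re_le_norm s).trans hs
  have him := (Complex.abs_im_le_norm s).trans hs
  have hW : 0 < ‖W‖ := by linarith
  have hpow : ‖W‖ ^ (-s).re ≤ (8 * (1 + y)) ^ N := by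
    rw [Complex.neg_re]
    rcases le_total 1 ‖W‖ with h | h
    · calc ‖W‖ ^ (-s.re) ≤ ‖W‖ ^ (N : ℝ) :=
            Real.rpow_le_rpow_of_exponent_le h (by linarith [neg_abs_le s.re])
        _ = ‖W‖ ^ N := Real.rpow_natCast _ _
        _ ≤ _ := by gcongr
    · calc ‖W‖ ^ (-s.re) ≤ ‖W‖ ^ (-(N : ℝ)) :=
            Real.rpow_le_rpow_of_exponent_ge hW h (by linarith [le_abs_self s.re])
        _ = (‖W‖⁻¹) ^ N := by rw [Real.rpow_neg hW.le, Real.rpow_natCast, inv_pow]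
        _ ≤ _ := by
            gcongr
            calc ‖W‖⁻¹ ≤ (1 / 2)⁻¹ := by gcongr
              _ ≤ _ := by norm_num; linarith
  have hexp : (8 * (1 + y)) ^ N ≤ 8 ^ N * N.factorial * Real.exp 1 * Real.exp y := by
    have h3 := Real.pow_div_factorial_le_exp (1 + y) (by linarith) N
    rw [div_le_iff₀ (by positivity), Real.exp_add] at h3
    calc (8 * (1 + y)) ^ N = 8 ^ N * (1 + y) ^ N := mul_pow _ _ _
      _ ≤ 8 ^ N * (Real.exp 1 * Real.exp y * N.factorial) := by gcongr
      _ = _ := by ring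
  have harg : (Real.exp (Complex.arg W * (-s).im))⁻¹ ≤ Real.exp (Real.pi * N) := by
    rw [← Real.exp_neg, Complex.neg_im]
    refine Real.exp_le_exp.mpr ?_
    calc -(W.arg * -s.im) ≤ |W.arg * s.im| := by rw [mul_neg, neg_neg]; exact le_abs_self _
      _ ≤ Real.pi * N := by
          rw [abs_mul]
          exact mul_le_mul (Complex.abs_arg_le_pi W) him (abs_nonneg _) Real.pi_pos.le
  have hnorm := Complex.norm_cpow_of_ne_zero (norm_pos_iff.mp hW) (-s)
  rw [hnorm, div_eq_mul_inv]
  calc _ ≤ (8 ^ N * N.factorial * Real.exp 1 * Real.exp y) * Real.exp (Real.pi * N) :=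
        mul_le_mul (hpow.trans hexp) harg (by positivity) (by positivity)
    _ = _ := by ring

/-! ### Hermite's formula for `g_q(s, s - 1, a)` and its limit -/

/-- The `q`-number `(1 - q ^ z) / (1 - q)` of a complex number `z`. -/
noncomputable def cqNumber (q : ℝ) (z : ℂ) : ℂ := (1 - (q : ℂ) ^ z) / ((1 - q : ℝ) : ℂ)

/-- The summand `q ^ (z (s - 1)) [z]_q ^ (-s)` of `g_q(s, s - 1, a)`. -/
noncomputable def qTerm (q : ℝ) (s z : ℂ) : ℂ := (q : ℂ) ^ (z * (s - 1)) * cqNumber q z ^ (-s)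

/-- The right side of the Abel–Plana formula for `g_q(s, s - 1, a)`. -/
noncomputable def qHermite (q a : ℝ) (s : ℂ) : ℂ :=
  qTerm q s a + ((1 - q) / (-Real.log q) : ℝ) * ((q : ℂ) ^ ((a + 1 / 2 : ℝ) * (s - 1)) *
    cqNumber q (a + 1 / 2 : ℝ) ^ (1 - s)) / (s - 1) -
    Complex.I * abelPlanaIntegral (qTerm q s) (a + 1 / 2)

/-- The right side of the midpoint form of Hermite's formula for `ζ(s, a)`. -/
noncomputable def hermite (a : ℝ) (s : ℂ) : ℂ :=
  (a : ℂ) ^ (-s) + ((a + 1 / 2 : ℝ) : ℂ) ^ (1 - s) / (s - 1) -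
    Complex.I * abelPlanaIntegral (fun z ↦ z ^ (-s)) (a + 1 / 2)

section

variable {q a : ℝ}

theorem one_sub_cpow_re_pos (hq0 : 0 < q) (hq1 : q < 1) {z : ℂ} (hz : 0 < z.re) :
    0 < (1 - (q : ℂ) ^ z).re := by
  have h1 : ((q : ℂ) ^ z).re ≤ q ^ z.re := by
    rw [← Complex.norm_cpow_eq_rpow_re_of_pos hq0]
    exact Complex.re_le_norm _
  have h2 := Real.rpow_lt_one hq0.le hq1 hz
  rw [Complex.sub_re, Complex.one_re]
  linarith

theorem cqNumber_re_pos (hq0 : 0 < q) (hq1 : q < 1) {z : ℂ} (hz : 0 < z.re) :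
    0 < (cqNumber q z).re := by
  rw [cqNumber, Complex.div_ofReal_re]
  exact div_pos (one_sub_cpow_re_pos hq0 hq1 hz) (sub_pos.mpr hq1)

theorem cqNumber_cpow (hq0 : 0 < q) (hq1 : q < 1) {z : ℂ} (hz : 0 < z.re) (s : ℂ) :
    cqNumber q z ^ (-s) = ((1 - q : ℝ) : ℂ) ^ s * (1 - (q : ℂ) ^ z) ^ (-s) := by
  have h1 : 0 < 1 - q := sub_pos.mpr hq1
  have h2 : 1 - (q : ℂ) ^ z ≠ 0 := fun h ↦ by
    have := one_sub_cpow_re_pos hq0 hq1 hz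
    rw [h] at this
    simp at this
  have h3 : cqNumber q z ≠ 0 := div_ne_zero h2 (by exact_mod_cast h1.ne')
  rw [Complex.cpow_def_of_ne_zero h3, Complex.cpow_def_of_ne_zero h2,
    Complex.cpow_def_of_ne_zero (by exact_mod_cast h1.ne'), ← Complex.exp_add, cqNumber,
    div_eq_inv_mul, ← Complex.ofReal_inv, Complex.log_ofReal_mul (by positivity) h2,
    Real.log_inv, Complex.ofReal_neg, Complex.ofReal_log h1.le]
  ring_nf

theorem qTerm_eq_qSummand (hq0 : 0 < q) (hq1 : q < 1) {z : ℂ} (hz : 0 < z.re) (s : ℂ) :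
    qTerm q s z = ((1 - q : ℝ) : ℂ) ^ s * qSummand q s (s - 1) z := by
  rw [qTerm, qSummand, cqNumber_cpow hq0 hq1 hz]
  ring

/-- The condition on `s` keeps all poles of the expansion away; `qHermite` itself has no singularity
at `s = 0, -1, -2, …` and provides the holomorphic extension there. -/
theorem qHurwitz_eq_qHermite (hq0 : 0 < q) (hq1 : q < 1) (ha : 0 < a) {s : ℂ}
    (hs : ∀ r : ℕ, s - 1 + r ≠ 0) (him : |Real.log q * s.im| < 2 * Real.pi) :
    qHurwitz q a s (s - 1) = qHermite q a s := by
  have hb : 0 < a + 1 / 2 := by positivity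
  have hε : ((1 - q : ℝ) : ℂ) ≠ 0 := by exact_mod_cast (sub_pos.mpr hq1).ne'
  rw [qHurwitz, tsum_qGeom_eq_abelPlana hq0 hq1 ha s hs (by simpa using him)
    (hasSum_risingCoeff_mul_cpow_div hq0 hq1 hb hs), qHermite,
    qTerm_eq_qSummand hq0 hq1 (by simpa using ha)]
  have h1 : abelPlanaIntegral (qTerm q s) (a + 1 / 2) = ((1 - q : ℝ) : ℂ) ^ s *
      ∫ y : ℝ in Set.Ioi 0, abelPlanaKernel y *
        (qSummand q s (s - 1) ((a + 1 / 2 : ℝ) + y * Complex.I) -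
          qSummand q s (s - 1) ((a + 1 / 2 : ℝ) - y * Complex.I)) := by
    rw [abelPlanaIntegral, ← integral_const_mul]
    refine integral_congr_ae (Eventually.of_forall fun y ↦ ?_)
    simp only
    rw [qTerm_eq_qSummand hq0 hq1 (by simpa using hb),
      qTerm_eq_qSummand hq0 hq1 (by simpa using hb)]
    ring
  have h2 : cqNumber q (a + 1 / 2 : ℝ) ^ (1 - s) = ((1 - q : ℝ) : ℂ) ^ (s - 1) *
      (1 - (q : ℂ) ^ ((a + 1 / 2 : ℝ) : ℂ)) ^ (-(s - 1)) := by
    rw [← neg_sub s 1, cqNumber_cpow hq0 hq1 (by simpa using hb)]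
  rw [h1, h2, Complex.cpow_sub _ _ hε, Complex.cpow_one, qSummand, qSummand]
  push_cast at hε ⊢
  field_simp

theorem qHurwitzTerm_eq_qTerm (q a : ℝ) (s : ℂ) (hq0 : 0 < q) (n : ℕ) :
    qHurwitzTerm q a s (s - 1) n = qTerm q s ((n + a : ℝ) : ℂ) := by
  rw [qHurwitzTerm, qTerm, qNumber, cqNumber]
  push_cast
  rw [Complex.ofReal_cpow hq0.le]
  push_cast
  rfl

/-- The `q`-number is the difference quotient at `1` of `x ↦ x^z`. -/
theorem tendsto_cqNumber (z : ℂ) : Tendsto (fun q : ℝ ↦ cqNumber q z) (𝓝[<] 1) (𝓝 z) := by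
  have h1 : HasDerivAt (fun x : ℂ ↦ x ^ z) z ((1 : ℝ) : ℂ) := by
    have := (hasDerivAt_id (1 : ℂ)).cpow_const (c := z) (by simp)
    simpa using this
  have h2 := h1.comp_ofReal
  rw [hasDerivAt_iff_tendsto_slope] at h2
  refine ((h2.mono_left (nhdsWithin_mono _ fun x hx ↦ ne_of_lt hx))).congr fun q ↦ ?_
  rw [slope_def_module, cqNumber, Complex.real_smul, Complex.ofReal_one, Complex.one_cpow,
    ← neg_sub q 1, Complex.ofReal_neg, ← neg_sub _ (1 : ℂ), neg_div_neg_eq, div_eq_inv_mul,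
    Complex.ofReal_inv]

theorem tendsto_ofReal_cpow_one (z : ℂ) :
    Tendsto (fun q : ℝ ↦ (q : ℂ) ^ z) (𝓝[<] 1) (𝓝 1) := by
  have h : ContinuousAt (fun q : ℝ ↦ (q : ℂ) ^ z) 1 :=
    ContinuousAt.cpow (by fun_prop) continuousAt_const (by simp)
  simpa using h.tendsto.mono_left nhdsWithin_le_nhds

theorem tendsto_qTerm (s : ℂ) {z : ℂ} (hz : 0 < z.re) :
    Tendsto (fun q : ℝ ↦ qTerm q s z) (𝓝[<] 1) (𝓝 (z ^ (-s))) := by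
  have h := (tendsto_cqNumber z).cpow (tendsto_const_nhds (x := -s)) (Or.inl hz)
  have h1 := (tendsto_ofReal_cpow_one (z * (s - 1))).mul h
  rwa [one_mul] at h1

theorem continuousAt_qTerm (hq0 : 0 < q) (hq1 : q < 1) (s : ℂ) {z : ℂ} (hz : 0 < z.re) :
    ContinuousAt (qTerm q s) z := by
  have h1 : ∀ {f : ℂ → ℂ}, Differentiable ℂ f → ContinuousAt (fun z ↦ (q : ℂ) ^ f z) z :=
    fun hf ↦ (differentiableAt_ofReal_cpow hq0 (hf z)).continuousAt
  refine (h1 (by fun_prop)).mul (ContinuousAt.cpow ?_ continuousAt_const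
    (Or.inl (cqNumber_re_pos hq0 hq1 hz)))
  exact ((h1 differentiable_id).const_sub 1).div_const _

theorem differentiable_qTerm (hq0 : 0 < q) (hq1 : q < 1) {z : ℂ} (hz : 0 < z.re) :
    Differentiable ℂ fun s ↦ qTerm q s z := by
  intro s
  have h : cqNumber q z ≠ 0 := fun h ↦ by
    have := cqNumber_re_pos hq0 hq1 hz
    rw [h] at this
    simp at this
  exact (differentiableAt_ofReal_cpow hq0 (by fun_prop)).mul
    (DifferentiableAt.const_cpow (by fun_prop) (Or.inl h))

/-- The bounds on `q` under which `q ^ (z (s - 1)) [z]_q ^ (-s)` is bounded uniformly in `q` and in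
`‖s‖ ≤ N`. -/
def NearOne (N : ℕ) (q : ℝ) : Prop := 1 / 2 < q ∧ q < 1 ∧ -Real.log q * (N + 1) ≤ 1 / 2

theorem tendsto_log_nhdsLT_one : Tendsto Real.log (𝓝[<] 1) (𝓝 0) := by
  have := (Real.continuousAt_log (x := 1) one_ne_zero).tendsto
  rw [Real.log_one] at this
  exact this.mono_left nhdsWithin_le_nhds

theorem eventually_nearOne (N : ℕ) : ∀ᶠ q in 𝓝[<] (1 : ℝ), NearOne N q := by
  have h1 : ∀ᶠ q in 𝓝[<] (1 : ℝ), 1 / 2 < q :=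
    nhdsWithin_le_nhds (lt_mem_nhds (by norm_num))
  have h2 : ∀ᶠ q in 𝓝[<] (1 : ℝ), -Real.log q * ((N : ℝ) + 1) ≤ 1 / 2 :=
    (tendsto_log_nhdsLT_one.neg.mul_const ((N : ℝ) + 1)).eventually
      (ge_mem_nhds (by rw [neg_zero, zero_mul]; norm_num))
  filter_upwards [h1, self_mem_nhdsWithin, h2] with q h1 h2 h3 using ⟨h1, h2, h3⟩

theorem norm_one_sub_exp_neg_le {w : ℂ} (hw : 0 ≤ w.re) : ‖1 - Complex.exp (-w)‖ ≤ 2 * ‖w‖ := by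
  rcases le_total ‖w‖ 1 with h | h
  · have := Complex.norm_exp_sub_one_le (x := -w) (by rwa [norm_neg])
    rwa [norm_neg, norm_sub_rev] at this
  · have h1 : ‖Complex.exp (-w)‖ ≤ 1 := by
      rw [Complex.norm_exp, Real.exp_le_one_iff]
      simpa using hw
    have := norm_sub_le (1 : ℂ) (Complex.exp (-w))
    rw [norm_one] at this
    linarith

/-- Below, `1 - √q ≥ (1-q)/2`. Above, `|1 - e^(-w)| ≤ 2|w|` with `w = -z log q`, `-log q ≤ 2(1-q)`
and `‖z‖ ≤ 2(1+y)`; hence the constant `8`. -/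
theorem NearOne.norm_cqNumber {N : ℕ} (h : NearOne N q) {y : ℝ} {z : ℂ} (hz : z ∈ halfStrip y) :
    1 / 2 ≤ ‖cqNumber q z‖ ∧ ‖cqNumber q z‖ ≤ 8 * (1 + y) := by
  obtain ⟨h1, h2, -⟩ := h
  obtain ⟨hz1, hz2⟩ := hz
  have hq0 : 0 < q := by linarith
  have hε : 0 < 1 - q := by linarith
  rw [cqNumber, norm_div, Complex.norm_real, Real.norm_of_nonneg hε.le, le_div_iff₀ hε,
    div_le_iff₀ hε]
  constructor
  · have h3 : q ^ z.re ≤ √q := by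
      rw [Real.sqrt_eq_rpow]
      exact Real.rpow_le_rpow_of_exponent_ge hq0 h2.le hz1
    have h4 := norm_sub_norm_le (1 : ℂ) ((q : ℂ) ^ z)
    rw [norm_one, Complex.norm_cpow_eq_rpow_re_of_pos hq0] at h4
    have h5 := Real.sq_sqrt hq0.le
    nlinarith [sq_nonneg (√q - 1)]
  · have hlog : -Real.log q ≤ 2 * (1 - q) := by
      have h3 := Real.one_sub_inv_le_log_of_pos hq0
      have h4 : q⁻¹ - 1 ≤ 2 * (1 - q) := by
        rw [show q⁻¹ - 1 = (1 - q) / q by field_simp, div_le_iff₀ hq0]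
        nlinarith
      linarith
    have hlog0 : 0 ≤ -Real.log q := by linarith [Real.log_nonpos hq0.le h2.le]
    have h3 := norm_one_sub_exp_neg_le (w := (-Real.log q : ℝ) * z)
      (by rw [Complex.re_ofReal_mul]; exact mul_nonneg hlog0 (by linarith))
    rw [norm_mul, Complex.norm_real, Real.norm_of_nonneg hlog0, Complex.ofReal_neg, neg_mul,
      neg_neg, ← ofReal_cpow_eq_exp hq0] at h3
    calc _ ≤ _ := h3
      _ ≤ 2 * (2 * (1 - q) * (2 * (1 + y))) := by gcongr
      _ = _ := by ring

/-- The constant of the uniform bound for `q ^ (z (s - 1)) [z]_q ^ (-s)`. -/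
noncomputable def termBound (N : ℕ) : ℝ :=
  8 ^ N * N.factorial * Real.exp 1 * Real.exp (Real.pi * N) * Real.exp 1

theorem NearOne.norm_qTerm_le {N : ℕ} (h : NearOne N q) {s : ℂ} (hs : ‖s‖ ≤ N) {y : ℝ}
    (hy : 0 ≤ y) {z : ℂ} (hz : z ∈ halfStrip y) :
    ‖qTerm q s z‖ ≤ termBound N * Real.exp (2 * y) := by
  obtain ⟨h1, h2⟩ := h.norm_cqNumber hz
  have h3 := norm_cpow_neg_le_mul_exp hy hs h1 h2
  have hq0 : 0 < q := by linarith [h.1]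
  have hlog0 : 0 ≤ -Real.log q := by linarith [Real.log_nonpos hq0.le h.2.1.le]
  -- The third condition in `NearOne` is chosen so that this factor costs only one more `e^y`.
  have h4 : ‖(q : ℂ) ^ (z * (s - 1))‖ ≤ Real.exp (1 + y) := by
    rw [ofReal_cpow_eq_exp hq0, Complex.norm_exp]
    refine Real.exp_le_exp.mpr ((Complex.re_le_norm _).trans ?_)
    have h5 : ‖s - 1‖ ≤ N + 1 := (norm_sub_le _ _).trans (by rw [norm_one]; linarith)
    rw [norm_mul, norm_mul, Complex.norm_real, Real.norm_eq_abs, abs_of_nonpos (by linarith)]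
    calc -Real.log q * (‖z‖ * ‖s - 1‖) ≤ -Real.log q * (2 * (1 + y) * (N + 1)) := by
          gcongr
          exact hz.2
      _ = (-Real.log q * (N + 1)) * (2 * (1 + y)) := by ring
      _ ≤ 1 / 2 * (2 * (1 + y)) := by gcongr; exact h.2.2
      _ = 1 + y := by ring
  rw [qTerm, norm_mul]
  calc _ ≤ Real.exp (1 + y) * _ := mul_le_mul h4 h3 (norm_nonneg _) (Real.exp_pos _).le
    _ = _ := by
      rw [termBound, Real.exp_add, two_mul y, Real.exp_add]
      ring

theorem norm_cpow_neg_le_termBound {N : ℕ} {s : ℂ} (hs : ‖s‖ ≤ N) {y : ℝ}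
    (hy : 0 ≤ y) {z : ℂ} (hz : z ∈ halfStrip y) :
    ‖z ^ (-s)‖ ≤ termBound N * Real.exp (2 * y) := by
  have h1 := norm_cpow_neg_le_mul_exp hy hs
    (hz.1.trans (Complex.re_le_norm z)) (hz.2.trans (by linarith))
  refine h1.trans ?_
  rw [termBound]
  have h2 : Real.exp y ≤ Real.exp (2 * y) := Real.exp_le_exp.mpr (by linarith)
  have h3 : 1 ≤ Real.exp 1 := Real.one_le_exp zero_le_one
  have h4 : 0 < 8 ^ N * N.factorial * Real.exp 1 * Real.exp (Real.pi * N) := by positivity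
  calc _ ≤ 8 ^ N * N.factorial * Real.exp 1 * Real.exp (Real.pi * N) * 1 * Real.exp (2 * y) := by
        rw [mul_one]; gcongr
    _ ≤ _ := by gcongr

theorem half_le_and_le (ha0 : 0 < a) (ha1 : a ≤ 1) : 1 / 2 ≤ a + 1 / 2 ∧ a + 1 / 2 ≤ 3 / 2 :=
  ⟨by linarith, by linarith⟩

theorem exists_ball_norm_le (s : ℂ) :
    ∃ N : ℕ, ‖s‖ + 1 ≤ N ∧ ∀ z ∈ Metric.ball s 1, ‖z‖ ≤ N := by
  obtain ⟨N, hN⟩ := exists_nat_ge (‖s‖ + 1)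
  refine ⟨N, hN, fun z hz ↦ ?_⟩
  rw [mem_ball_iff_norm] at hz
  linarith [norm_le_norm_add_norm_sub' z s]

theorem NearOne.differentiableAt_qHermite {N : ℕ} (h : NearOne N q) (ha0 : 0 < a) (ha1 : a ≤ 1)
    {s : ℂ} (hs : s ≠ 1) {R : ℝ} (hR : 0 < R) (hN : ∀ z ∈ Metric.ball s R, ‖z‖ ≤ N) :
    DifferentiableAt ℂ (qHermite q a) s := by
  obtain ⟨hb0, hb1⟩ := half_le_and_le ha0 ha1
  have hq0 : 0 < q := by linarith [h.1]
  have hq1 := h.2.1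
  have h0 : cqNumber q (a + 1 / 2 : ℝ) ≠ 0 := fun h ↦ by
    have := cqNumber_re_pos hq0 hq1 (z := (a + 1 / 2 : ℝ))
      (by rw [Complex.ofReal_re]; linarith)
    rw [h] at this
    simp at this
  refine DifferentiableAt.sub (DifferentiableAt.add ?_ (DifferentiableAt.div
    (DifferentiableAt.const_mul (DifferentiableAt.mul ?_ ?_) _) (by fun_prop)
    (sub_ne_zero.mpr hs))) (DifferentiableAt.const_mul ?_ _)
  · exact differentiable_qTerm hq0 hq1 (by simpa using ha0) s
  · exact differentiableAt_ofReal_cpow hq0 (by fun_prop)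
  · exact DifferentiableAt.const_cpow (by fun_prop) (Or.inl h0)
  · exact differentiableAt_abelPlanaIntegral hR hb0 hb1 (termBound N)
      (fun s z hz ↦ continuousAt_qTerm hq0 hq1 s hz)
      (fun z hz ↦ differentiable_qTerm hq0 hq1 hz)
      fun s hs y hy z hz ↦ h.norm_qTerm_le (hN s hs) hy hz

theorem differentiableAt_hermite (ha0 : 0 < a) (ha1 : a ≤ 1) {s : ℂ} (hs : s ≠ 1) :
    DifferentiableAt ℂ (hermite a) s := by
  obtain ⟨hb0, hb1⟩ := half_le_and_le ha0 ha1
  obtain ⟨N, -, hN⟩ := exists_ball_norm_le s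
  have hne : ∀ {z : ℂ}, 0 < z.re → z ≠ 0 := fun hz h ↦ by rw [h] at hz; simp at hz
  refine DifferentiableAt.sub (DifferentiableAt.add ?_ (DifferentiableAt.div ?_ (by fun_prop)
    (sub_ne_zero.mpr hs))) (DifferentiableAt.const_mul ?_ _)
  · exact DifferentiableAt.const_cpow (by fun_prop) (Or.inl (by exact_mod_cast ha0.ne'))
  · exact DifferentiableAt.const_cpow (by fun_prop)
      (Or.inl (hne (by rw [Complex.ofReal_re]; linarith)))
  · exact differentiableAt_abelPlanaIntegral one_pos hb0 hb1 (termBound N)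
      (fun s z hz ↦ ContinuousAt.cpow continuousAt_id continuousAt_const (Or.inl hz))
      (fun z hz s ↦ DifferentiableAt.const_cpow (by fun_prop) (Or.inl (hne hz)))
      fun s hs y hy z hz ↦ norm_cpow_neg_le_termBound (hN s hs) hy hz

theorem tendsto_one_sub_div_neg_log :
    Tendsto (fun q : ℝ ↦ (1 - q) / (-Real.log q)) (𝓝[<] 1) (𝓝 1) := by
  have h := (Real.hasDerivAt_log (one_ne_zero (α := ℝ)))
  rw [hasDerivAt_iff_tendsto_slope] at h
  have h1 := (h.mono_left (nhdsWithin_mono _ fun x (hx : x ∈ Set.Iio (1 : ℝ)) ↦ ne_of_lt hx)).inv₀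
    (by norm_num)
  rw [inv_one, inv_one] at h1
  refine h1.congr fun q ↦ ?_
  rw [slope_def_field, Real.log_one, sub_zero, inv_div, ← neg_sub q 1, neg_div_neg_eq]

theorem tendsto_qHermite (ha0 : 0 < a) (ha1 : a ≤ 1) (s : ℂ) :
    Tendsto (fun q ↦ qHermite q a s) (𝓝[<] 1) (𝓝 (hermite a s)) := by
  obtain ⟨hb0, hb1⟩ := half_le_and_le ha0 ha1
  obtain ⟨N, hN, -⟩ := exists_ball_norm_le s
  have h1 := tendsto_qTerm s (z := a) (by simpa using ha0)
  have h2 := (Complex.continuous_ofReal.tendsto _).comp tendsto_one_sub_div_neg_log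
  have h3 := tendsto_ofReal_cpow_one ((a + 1 / 2 : ℝ) * (s - 1))
  have h4 := (tendsto_cqNumber (a + 1 / 2 : ℝ)).cpow (tendsto_const_nhds (x := 1 - s))
    (Or.inl (by rw [Complex.ofReal_re]; linarith))
  have h5 : Tendsto (fun q ↦ abelPlanaIntegral (qTerm q s) (a + 1 / 2)) (𝓝[<] 1)
      (𝓝 (abelPlanaIntegral (fun z ↦ z ^ (-s)) (a + 1 / 2))) := by
    refine tendsto_abelPlanaIntegral hb0 hb1 (termBound N) ?_ ?_ fun z hz ↦ tendsto_qTerm s hz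
    · filter_upwards [eventually_nearOne N] with q hq z hz
      exact continuousAt_qTerm (by linarith [hq.1]) hq.2.1 s hz
    · filter_upwards [eventually_nearOne N] with q hq y hy z hz
      exact hq.norm_qTerm_le (by linarith) hy hz
  have h6 := (h1.add ((h2.mul (h3.mul h4)).div_const (s - 1))).sub (h5.const_mul Complex.I)
  rw [Complex.ofReal_one, one_mul, one_mul] at h6
  exact h6

/-- `1 - q^x = 2 q^(x/2) sinh h` with `h = -(x/2) log q`. Use `sinh h ≥ h` and `-log q ≥ 1 - q`. -/
theorem mul_rpow_half_le_qNumber (hq0 : 0 < q) (hq1 : q < 1) {x : ℝ} (hx : 0 ≤ x) :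
    x * q ^ (x / 2) ≤ qNumber q x := by
  have hlog : 1 - q ≤ -Real.log q := by linarith [Real.log_le_sub_one_of_pos hq0]
  rw [qNumber, le_div_iff₀ (by linarith)]
  set h : ℝ := -Real.log q * (x / 2) with hh
  have h0 : 0 ≤ h := mul_nonneg (by linarith) (by linarith)
  have h1 : q ^ (x / 2) = Real.exp (-h) := by
    rw [Real.rpow_def_of_pos hq0, hh]; ring_nf
  have h2 : q ^ x = Real.exp (-h) * Real.exp (-h) := by
    rw [← Real.exp_add, Real.rpow_def_of_pos hq0, hh]; ring_nf
  have h3 : 2 * h ≤ Real.exp h - Real.exp (-h) := by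
    have := Real.self_le_sinh_iff.mpr h0
    rw [Real.sinh_eq] at this
    linarith
  have h4 : Real.exp h * Real.exp (-h) = 1 := by rw [← Real.exp_add, add_neg_cancel, Real.exp_zero]
  rw [h1, h2]
  have h5 : x * (1 - q) ≤ 2 * h := by rw [hh]; nlinarith
  nlinarith [Real.exp_pos (-h)]

/-- After the preceding bound the remaining power of `q` has exponent `x (Re s / 2 - 1)`,
nonnegative for `Re s ≥ 2`. This gives a majorant free of `q`, and is why the comparison is made on
`Re s > 2`. -/
theorem norm_qTerm_ofReal_le (hq0 : 0 < q) (hq1 : q < 1) {s : ℂ} (hs : 2 < s.re) {x : ℝ}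
    (hx : 0 < x) : ‖qTerm q s x‖ ≤ x ^ (-s.re) := by
  have h1 := mul_rpow_half_le_qNumber hq0 hq1 hx.le
  have h2 : 0 < q ^ (x / 2) := by positivity
  have h3 : cqNumber q x = (qNumber q x : ℝ) := by
    rw [cqNumber, qNumber, Complex.ofReal_div, Complex.ofReal_sub 1 (q ^ x),
      Complex.ofReal_cpow hq0.le, Complex.ofReal_one]
  have h4 : 0 < qNumber q x := lt_of_lt_of_le (by positivity) h1
  rw [qTerm, norm_mul, Complex.norm_cpow_eq_rpow_re_of_pos hq0, h3,
    Complex.norm_cpow_eq_rpow_re_of_pos h4, Complex.neg_re, Complex.re_ofReal_mul]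
  simp only [Complex.sub_re, Complex.one_re]
  have h5 : qNumber q x ^ (-s.re) ≤ (x * q ^ (x / 2)) ^ (-s.re) :=
    Real.rpow_le_rpow_of_nonpos (by positivity) h1 (by linarith)
  rw [Real.mul_rpow hx.le h2.le, ← Real.rpow_mul hq0.le] at h5
  calc _ ≤ q ^ (x * (s.re - 1)) * (x ^ (-s.re) * q ^ (x / 2 * -s.re)) := by gcongr
    _ = x ^ (-s.re) * q ^ (x * (s.re - 1) + x / 2 * -s.re) := by
        rw [Real.rpow_add hq0]; ring
    _ ≤ x ^ (-s.re) * 1 := by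
        gcongr
        refine Real.rpow_le_one hq0.le hq1.le ?_
        nlinarith
    _ = _ := mul_one _

/-- Both sides are limits of `g_q(s, s-1, a)`: one through the Abel–Plana form, the other term by
term in the series. -/
theorem hermite_eq_hurwitzZeta_of_two_lt_re (ha0 : 0 < a) (ha1 : a ≤ 1) {s : ℂ} (hs : 2 < s.re) :
    hermite a s = HurwitzZeta.hurwitzZeta (a : UnitAddCircle) s := by
  have hz := HurwitzZeta.hasSum_hurwitzZeta_of_one_lt_re (a := a) ⟨ha0.le, ha1⟩
    (s := s) (by linarith)
  have hpos : ∀ n : ℕ, 0 < (n : ℝ) + a := fun n ↦ by positivity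
  have hterm : ∀ n : ℕ, 1 / ((n : ℂ) + a) ^ s = ((n + a : ℝ) : ℂ) ^ (-s) := fun n ↦ by
    rw [Complex.cpow_neg, one_div]
    push_cast
    rfl
  simp only [hterm] at hz
  have hsum : Summable fun n : ℕ ↦ ((n : ℝ) + a) ^ (-s.re) := by
    refine hz.summable.norm.congr fun n ↦ ?_
    rw [Complex.norm_cpow_eq_rpow_re_of_pos (hpos n), Complex.neg_re]
  have hq : ∀ᶠ q in 𝓝[<] (1 : ℝ), 0 < q ∧ q < 1 := by
    filter_upwards [eventually_nearOne 0] with q hq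
    exact ⟨by linarith [hq.1], hq.2.1⟩
  have h1 : Tendsto (fun q : ℝ ↦ ∑' n : ℕ, qTerm q s ((n + a : ℝ) : ℂ)) (𝓝[<] 1)
      (𝓝 (∑' n : ℕ, ((n + a : ℝ) : ℂ) ^ (-s))) := by
    refine tendsto_tsum_of_dominated_convergence hsum
      (fun n ↦ tendsto_qTerm s (by simpa using hpos n)) ?_
    filter_upwards [hq] with q hq n
    exact norm_qTerm_ofReal_le hq.1 hq.2 hs (hpos n)
  rw [hz.tsum_eq] at h1
  have him : ∀ᶠ q in 𝓝[<] (1 : ℝ), |Real.log q * s.im| < 2 * Real.pi := by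
    have := (tendsto_log_nhdsLT_one.mul_const s.im).abs
    rw [zero_mul, abs_zero] at this
    exact this.eventually (gt_mem_nhds (by positivity))
  refine tendsto_nhds_unique (tendsto_qHermite ha0 ha1 s) (h1.congr' ?_)
  filter_upwards [hq, him] with q hq him
  rw [← qHurwitz_eq_qHermite hq.1 hq.2 ha0 (fun r h ↦ ?_) him,
    ← (hasSum_qHurwitzTerm hq.1 hq.2 ha0 s (t := s - 1)
      (by rw [Complex.sub_re, Complex.one_re]; linarith)).tsum_eq]
  · exact tsum_congr fun n ↦ (qHurwitzTerm_eq_qTerm q a s hq.1 n).symm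
  · have := congrArg Complex.re h
    simp only [Complex.add_re, Complex.sub_re, Complex.one_re, Complex.natCast_re,
      Complex.zero_re] at this
    linarith [r.cast_nonneg (α := ℝ)]

/-- Hermite's formula for the Hurwitz zeta function. -/
theorem hermite_eq_hurwitzZeta (ha0 : 0 < a) (ha1 : a ≤ 1) {s : ℂ} (hs : s ≠ 1) :
    hermite a s = HurwitzZeta.hurwitzZeta (a : UnitAddCircle) s := by
  have hopen : IsOpen ({1}ᶜ : Set ℂ) := isOpen_compl_singleton
  have h1 : AnalyticOnNhd ℂ (hermite a) {1}ᶜ := DifferentiableOn.analyticOnNhd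
    (fun z hz ↦ (differentiableAt_hermite ha0 ha1 hz).differentiableWithinAt) hopen
  have h2 : AnalyticOnNhd ℂ (HurwitzZeta.hurwitzZeta (a : UnitAddCircle)) {1}ᶜ :=
    DifferentiableOn.analyticOnNhd (fun z hz ↦
      (HurwitzZeta.differentiableAt_hurwitzZeta _ hz).differentiableWithinAt) hopen
  have hconn : IsPreconnected ({1}ᶜ : Set ℂ) :=
    (isConnected_compl_singleton_of_one_lt_rank
      (by rw [Complex.rank_real_complex]; norm_num) 1).isPreconnected
  refine h1.eqOn_of_preconnected_of_eventuallyEq h2 hconn (z₀ := 3) (by simp) ?_ hs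
  filter_upwards [Complex.continuous_re.continuousAt.eventually
    (lt_mem_nhds (show (2 : ℝ) < (3 : ℂ).re by norm_num))] with z hz
  exact hermite_eq_hurwitzZeta_of_two_lt_re ha0 ha1 hz

end

/-! ### Sufficiency: regularity and limits along `s - ν` -/

section

variable {q a : ℝ}

theorem eventually_nhdsLT_one : ∀ᶠ q in 𝓝[<] (1 : ℝ), 0 < q ∧ q < 1 := by
  filter_upwards [eventually_nearOne 0] with q hq
  exact ⟨by linarith [hq.1], hq.2.1⟩

theorem eventually_abs_log_mul_lt (c : ℝ) :
    ∀ᶠ q in 𝓝[<] (1 : ℝ), |Real.log q * c| < 2 * Real.pi := by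
  have := (tendsto_log_nhdsLT_one.mul_const c).abs
  rw [zero_mul, abs_zero] at this
  exact this.eventually (gt_mem_nhds (by positivity))

/-- The poles with `m ≠ 0` have imaginary part at least `2π/|log q|` in absolute value, so for `q`
near `1` only `0, -1, -2, …` matter. -/
theorem notMem_qPolarSet (hq0 : 0 < q) (hq1 : q < 1) {t : ℂ} (ht : ∀ k : ℕ, t + k ≠ 0)
    (him : |Real.log q * t.im| < 2 * Real.pi) : t ∉ qPolarSet q := by
  rintro ⟨k, hk⟩
  have hl : (Real.log q : ℂ) ≠ 0 := by exact_mod_cast (Real.log_neg hq0 hq1).ne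
  rw [ofReal_cpow_eq_exp hq0] at hk
  exact cexp_ne_one_of_abs_im_lt (mul_ne_zero hl (ht k))
    (by rw [Complex.im_ofReal_mul]; simpa using him) hk

theorem neg_natCast_mem_qPolarSet (k : ℕ) : (-(k : ℂ)) ∈ qPolarSet q := ⟨k, by simp⟩

theorem eventually_nhdsNE_ne (s c : ℂ) : ∀ᶠ z in 𝓝[≠] s, z ≠ c := by
  by_cases h : c = s
  · rw [h]; exact self_mem_nhdsWithin
  · exact nhdsWithin_le_nhds (isOpen_ne.mem_nhds (Ne.symm h))

theorem eventually_nhdsNE_add_natCast_ne_zero (s c : ℂ) :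
    ∀ᶠ z in 𝓝[≠] s, ∀ k : ℕ, z - c + k ≠ 0 := by
  obtain ⟨R, hR⟩ := exists_two_le_add_natCast (s.re - c.re)
  have h1 : ∀ᶠ z : ℂ in 𝓝[≠] s, s.re - 1 < z.re :=
    nhdsWithin_le_nhds (Complex.continuous_re.continuousAt.eventually (lt_mem_nhds (by simp)))
  have h2 : ∀ k ∈ Finset.range R, ∀ᶠ z : ℂ in 𝓝[≠] s, z ≠ c - k := fun k _ ↦
    eventually_nhdsNE_ne _ _
  filter_upwards [h1, (Filter.eventually_all_finset _).mpr h2] with z hz1 hz2 k hk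
  by_cases hkR : k < R
  · exact hz2 k (Finset.mem_range.mpr hkR) (by linear_combination hk)
  · have h3 : (R : ℝ) ≤ k := by exact_mod_cast not_lt.mp hkR
    have h4 := congrArg Complex.re hk
    simp only [Complex.add_re, Complex.sub_re, Complex.natCast_re, Complex.zero_re] at h4
    linarith

theorem valueAlong_eq {G : ℂ → ℂ → ℂ} {φ : ℂ → ℂ} {s : ℂ} {F : ℂ → ℂ} (hF : ContinuousAt F s)
    (h : F =ᶠ[𝓝[≠] s] fun z ↦ G z (φ z)) : valueAlong G φ s = F s :=
  ((hF.tendsto.mono_left nhdsWithin_le_nhds).congr' h).limUnder_eq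

theorem tendsto_sub_one_nhdsNE (s : ℂ) : Tendsto (fun z : ℂ ↦ z - 1) (𝓝[≠] s) (𝓝[≠] (s - 1)) := by
  refine tendsto_nhdsWithin_iff.mpr ⟨?_, ?_⟩
  · exact ((continuous_sub_right (1 : ℂ)).tendsto s).mono_left nhdsWithin_le_nhds
  · filter_upwards [self_mem_nhdsWithin] with z hz h
    exact hz (sub_left_injective h)

/-- Induction on `ν`. The recurrence at `t = s - ν - 1` reads `g(s, s-ν-1) = g(s, s-ν) + (1-q)
g(s-1, (s-1)-ν)`, and the last value converges, so its product with `1 - q` vanishes. Evaluating at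
`s - 1` is what adds the exceptional point `ν + 1`. -/
theorem regularAlong_sub_natCast (ha0 : 0 < a) (ha1 : a ≤ 1) {G : ℝ → ℂ → ℂ → ℂ}
    (hG : ∀ q : ℝ, 0 < q → q < 1 → IsQHurwitz q a (G q)) {ν : ℕ} (hν : 1 ≤ ν) :
    ∀ s : ℂ, (∀ j : ℕ, 1 ≤ j → j ≤ ν → s ≠ (j : ℂ)) →
      (∀ᶠ q in 𝓝[<] (1 : ℝ), RegularAlong q (G q) (fun z ↦ z - (ν : ℂ)) s) ∧
      Tendsto (fun q ↦ valueAlong (G q) (fun z ↦ z - (ν : ℂ)) s) (𝓝[<] (1 : ℝ))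
        (𝓝 (HurwitzZeta.hurwitzZeta (a : UnitAddCircle) s)) := by
  induction ν, hν using Nat.le_induction with
  | base =>
    intro s hs
    have hs1 : s ≠ 1 := by simpa using hs 1 le_rfl le_rfl
    obtain ⟨N, -, hN⟩ := exists_ball_norm_le s
    have key : ∀ᶠ q in 𝓝[<] (1 : ℝ), (∀ᶠ z in 𝓝[≠] s, z - ((1 : ℕ) : ℂ) ∉ qPolarSet q) ∧
        AnalyticAt ℂ (qHermite q a) s ∧
        qHermite q a =ᶠ[𝓝[≠] s] fun z ↦ G q z (z - ((1 : ℕ) : ℂ)) := by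
      filter_upwards [eventually_nhdsLT_one, eventually_nearOne N,
        eventually_abs_log_mul_lt s.im] with q hq hqN him
      have him' : ∀ᶠ z : ℂ in 𝓝[≠] s, |Real.log q * z.im| < 2 * Real.pi := by
        have : ContinuousAt (fun z : ℂ ↦ |Real.log q * z.im|) s :=
          (continuous_const.mul Complex.continuous_im).abs.continuousAt
        exact nhdsWithin_le_nhds (this.eventually (gt_mem_nhds him))
      have hpolar : ∀ᶠ z in 𝓝[≠] s, z - ((1 : ℕ) : ℂ) ∉ qPolarSet q := by
        filter_upwards [him', eventually_nhdsNE_add_natCast_ne_zero s ((1 : ℕ) : ℂ)] with z h1 h2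
        exact notMem_qPolarSet hq.1 hq.2 h2 (by simpa using h1)
      refine ⟨hpolar, ?_, ?_⟩
      · rw [Complex.analyticAt_iff_eventually_differentiableAt]
        have hball : ∀ᶠ z in 𝓝 s, z ∈ Metric.ball s 1 := Metric.ball_mem_nhds s one_pos
        filter_upwards [hball, isOpen_ne.mem_nhds hs1] with z hz1 hz2
        obtain ⟨R, hR, hsub⟩ := Metric.isOpen_iff.mp Metric.isOpen_ball z hz1
        exact hqN.differentiableAt_qHermite ha0 ha1 hz2 hR fun w hw ↦ hN w (hsub hw)
      · filter_upwards [him', hpolar, eventually_nhdsNE_add_natCast_ne_zero s 1] with z h1 h2 h3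
        rw [(hG q hq.1 hq.2).eq_qHurwitz hq.1 hq.2 ha0 z h2, Nat.cast_one,
          qHurwitz_eq_qHermite hq.1 hq.2 ha0 h3 h1]
    refine ⟨key.mono fun q hq ↦ ⟨hq.1, _, hq.2⟩, ?_⟩
    rw [← hermite_eq_hurwitzZeta ha0 ha1 hs1]
    refine (tendsto_qHermite ha0 ha1 s).congr' (key.mono fun q hq ↦ ?_)
    exact (valueAlong_eq hq.2.1.continuousAt hq.2.2).symm
  | succ ν hν ih =>
    intro s hs
    obtain ⟨r1, t1⟩ := ih s fun j h1 h2 ↦ hs j h1 (by omega)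
    obtain ⟨r2, t2⟩ := ih (s - 1) fun j h1 h2 h ↦ hs (j + 1) (by omega) (by omega)
      (by push_cast; linear_combination h)
    have key : ∀ᶠ q in 𝓝[<] (1 : ℝ),
        RegularAlong q (G q) (fun z ↦ z - ((ν + 1 : ℕ) : ℂ)) s ∧
        valueAlong (G q) (fun z ↦ z - ((ν + 1 : ℕ) : ℂ)) s =
          valueAlong (G q) (fun z ↦ z - (ν : ℂ)) s +
            (1 - q : ℝ) * valueAlong (G q) (fun z ↦ z - (ν : ℂ)) (s - 1) := by
      filter_upwards [eventually_nhdsLT_one, r1, r2] with q hq h1 h2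
      obtain ⟨p1, F1, a1, e1⟩ := h1
      obtain ⟨p2, F2, a2, e2⟩ := h2
      have hsub := tendsto_sub_one_nhdsNE s
      have hcast : ∀ z : ℂ, z - 1 - ν = z - ((ν + 1 : ℕ) : ℂ) := fun z ↦ by push_cast; ring
      have p3 : ∀ᶠ z in 𝓝[≠] s, z - ((ν + 1 : ℕ) : ℂ) ∉ qPolarSet q := by
        filter_upwards [hsub.eventually p2] with z hz
        rwa [← hcast]
      have han : AnalyticAt ℂ (fun z ↦ F1 z + ((1 - q : ℝ) : ℂ) * F2 (z - 1)) s :=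
        a1.add (analyticAt_const.mul (AnalyticAt.fun_comp (f := fun z ↦ z - 1) a2 (by fun_prop)))
      have heq : (fun z ↦ F1 z + ((1 - q : ℝ) : ℂ) * F2 (z - 1)) =ᶠ[𝓝[≠] s]
          fun z ↦ G q z (z - ((ν + 1 : ℕ) : ℂ)) := by
        filter_upwards [p1, p3, e1, hsub.eventually e2] with z h1 h2 h3 h4
        have hGq := hG q hq.1 hq.2
        rw [h3, h4, hcast, hGq.eq_qHurwitz hq.1 hq.2 ha0 _ h1,
          hGq.eq_qHurwitz hq.1 hq.2 ha0 _ h2, hGq.eq_qHurwitz hq.1 hq.2 ha0 _ h2,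
          qHurwitz_eq_add hq.1 hq.2 ha0 z (z - ((ν + 1 : ℕ) : ℂ))]
        congr 2
        push_cast
        ring
      refine ⟨⟨p3, _, han, heq⟩, ?_⟩
      rw [valueAlong_eq han.continuousAt heq, valueAlong_eq a1.continuousAt e1,
        valueAlong_eq a2.continuousAt e2]
    refine ⟨key.mono fun q hq ↦ hq.1, ?_⟩
    have hε : Tendsto (fun q : ℝ ↦ ((1 - q : ℝ) : ℂ)) (𝓝[<] 1) (𝓝 0) := by
      have : Continuous fun q : ℝ ↦ ((1 - q : ℝ) : ℂ) := by fun_prop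
      simpa using (this.tendsto 1).mono_left nhdsWithin_le_nhds
    have hlim := t1.add (hε.mul t2)
    rw [zero_mul, add_zero] at hlim
    exact hlim.congr' (key.mono fun q hq ↦ hq.2.symm)

/-- The function `z ↦ g_q(z, z - ν, a)` has a genuine pole at `1, …, ν`. -/
theorem not_regularAlong_natCast (hq0 : 0 < q) (hq1 : q < 1) (ha : 0 < a) {G : ℂ → ℂ → ℂ}
    (hG : IsQHurwitz q a G) {ν j : ℕ} (hj1 : 1 ≤ j) (hjν : j ≤ ν) :
    ¬ RegularAlong q G (fun z ↦ z - (ν : ℂ)) j := by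
  rintro ⟨hp, F, hF, heq⟩
  obtain ⟨i, rfl⟩ := Nat.exists_eq_add_of_le hjν
  have hqne : (q : ℂ) ≠ 0 := by exact_mod_cast hq0.ne'
  have hsubν : ∀ z : ℂ, z - ((j + i : ℕ) : ℂ) + i = z - j := fun z ↦ by push_cast; ring
  -- the terms of the expansion other than the `i`-th are continuous
  set rest : ℂ → ℂ := fun z ↦
    ∑ r ∈ (Finset.range (j + i + 2)).erase i,
      risingCoeff z r * qGeom q a (z - ((j + i : ℕ) : ℂ) + r) +
    ∑' r : ℕ, risingCoeff z (r + (j + i + 2)) *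
      qGeom q a (z - ((j + i : ℕ) : ℂ) + (r + (j + i + 2) : ℕ)) with hrest
  have hcont : ContinuousAt rest j := by
    refine ContinuousAt.add (tendsto_finsetSum _ fun r hr ↦ ?_) ?_
    · refine (differentiable_risingCoeff r _).continuousAt.mul
        (differentiableAt_qGeom hq0 (by fun_prop) ?_).continuousAt
      refine ofReal_cpow_ne_one hq0 hq1 ?_
      have hri : (r : ℝ) ≠ i := by exact_mod_cast Finset.ne_of_mem_erase hr
      push_cast
      simp only [Complex.add_re, Complex.sub_re, Complex.natCast_re]
      intro h
      exact hri (by linarith)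
    · have h1 := (differentiableAt_qHurwitz_tail hq0 hq1 ha (j : ℂ) ((j : ℂ) - ((j + i : ℕ) : ℂ))
        (R := j + i + 2) (by
          push_cast
          simp only [Complex.add_re, Complex.sub_re, Complex.natCast_re]
          linarith [j.cast_nonneg (α := ℝ)])).continuousAt
      exact ContinuousAt.comp (f := fun z : ℂ ↦ (z, z - ((j + i : ℕ) : ℂ))) h1 (by fun_prop)
  have hε : ((1 - q : ℝ) : ℂ) ≠ 0 := by exact_mod_cast (sub_pos.mpr hq1).ne'
  have hpow : ∀ {c : ℝ}, 0 < c → ∀ {f : ℂ → ℂ}, Differentiable ℂ f →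
      ContinuousAt (fun z ↦ (c : ℂ) ^ f z) (j : ℂ) :=
    fun hc _ hf ↦ (differentiableAt_ofReal_cpow hc (hf _)).continuousAt
  -- Multiply by `1 - q^(z-j)`, which vanishes at `j`. A holomorphic extension would give limit `0`,
  -- whereas the `i`-th term, `i = ν - j`, leaves `(1-q)^j c_i(j) ≠ 0`.
  have hlim1 : Tendsto (fun z : ℂ ↦ (1 - (q : ℂ) ^ (z - j)) * F z) (𝓝[≠] (j : ℂ)) (𝓝 0) := by
    have : ContinuousAt (fun z : ℂ ↦ (1 - (q : ℂ) ^ (z - j)) * F z) j :=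
      ((hpow hq0 (by fun_prop)).const_sub 1).mul hF.continuousAt
    simpa using this.tendsto.mono_left nhdsWithin_le_nhds
  have hlim2 : Tendsto (fun z : ℂ ↦ ((1 - q : ℝ) : ℂ) ^ z * (risingCoeff z i *
      (q : ℂ) ^ ((a : ℂ) * (z - j)) + (1 - (q : ℂ) ^ (z - j)) * rest z)) (𝓝[≠] (j : ℂ))
      (𝓝 (((1 - q : ℝ) : ℂ) ^ (j : ℂ) * risingCoeff j i)) := by
    have : ContinuousAt (fun z : ℂ ↦ ((1 - q : ℝ) : ℂ) ^ z * (risingCoeff z i *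
      (q : ℂ) ^ ((a : ℂ) * (z - j)) + (1 - (q : ℂ) ^ (z - j)) * rest z)) j := by
      refine (hpow (sub_pos.mpr hq1) differentiable_id).mul (ContinuousAt.add
        ((differentiable_risingCoeff i _).continuousAt.mul (hpow hq0 (by fun_prop)))
        (((hpow hq0 (by fun_prop)).const_sub 1).mul hcont))
    simpa using this.tendsto.mono_left nhdsWithin_le_nhds
  refine mul_ne_zero ?_ (risingCoeff_natCast_ne_zero hj1 i)
    (tendsto_nhds_unique (hlim2.congr' ?_) hlim1)
  · rw [Complex.cpow_ne_zero_iff]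
    exact Or.inl hε
  · filter_upwards [hp, heq] with z hz1 hz2
    have hne : 1 - (q : ℂ) ^ (z - j) ≠ 0 := fun h ↦
      hz1 ⟨i, by rw [hsubν]; exact (sub_eq_zero.mp h).symm⟩
    rw [hz2, hG.eq_qHurwitz hq0 hq1 ha z hz1,
      qHurwitz_eq_sum_add_tail hq0 hq1 ha _ _ (j + i + 2),
      ← Finset.add_sum_erase _ _ (Finset.mem_range.mpr (by omega : i < j + i + 2)),
      add_assoc, hsubν]
    rw [hrest, qGeom]
    field_simp

end

/-! ### Necessity: the beta function as an obstruction -/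

/-- The coefficient `x (x + 1) ⋯ (x + r - 1) / r!` for real `x`. -/
noncomputable def realRisingCoeff (x : ℝ) (r : ℕ) : ℝ := ∏ j ∈ Finset.range r, (x + j) / (j + 1)

theorem risingCoeff_ofReal (x : ℝ) (r : ℕ) : risingCoeff x r = (realRisingCoeff x r : ℝ) := by
  rw [risingCoeff, realRisingCoeff]
  push_cast
  rfl

section

variable {q a x : ℝ}

theorem realRisingCoeff_succ (x : ℝ) (r : ℕ) :
    realRisingCoeff x (r + 1) = realRisingCoeff x r * ((x + r) / (r + 1)) := by
  simp only [realRisingCoeff, Finset.prod_range_succ]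

theorem realRisingCoeff_pos (hx0 : 0 < x) (r : ℕ) : 0 < realRisingCoeff x r :=
  Finset.prod_pos fun j _ ↦ by positivity

theorem realRisingCoeff_sub_succ (x : ℝ) (r : ℕ) :
    realRisingCoeff x r - realRisingCoeff x (r + 1) =
      (1 - x) * (realRisingCoeff x r / (r + 1)) := by
  rw [realRisingCoeff_succ]
  field_simp
  ring

theorem antitone_realRisingCoeff (hx0 : 0 < x) (hx1 : x < 1) : Antitone (realRisingCoeff x) := by
  refine antitone_nat_of_succ_le fun r ↦ sub_nonneg.mp ?_
  rw [realRisingCoeff_sub_succ]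
  have h1 := realRisingCoeff_pos hx0 r
  have h2 : 0 < 1 - x := by linarith
  positivity

/-- The terms are, up to the factor `1 - x`, the decrements of a positive sequence, so the partial
sums telescope and stay bounded. -/
theorem summable_realRisingCoeff_div (hx0 : 0 < x) (hx1 : x < 1) :
    Summable fun r : ℕ ↦ realRisingCoeff x r / (r + 1) := by
  have h2 : 0 < 1 - x := by linarith
  refine summable_of_sum_range_le (c := 1 / (1 - x)) (fun r ↦ ?_) fun R ↦ ?_
  · have := realRisingCoeff_pos hx0 r
    positivity
  · rw [le_div_iff₀ h2, mul_comm, Finset.mul_sum,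
      Finset.sum_congr rfl fun r _ ↦ (realRisingCoeff_sub_succ x r).symm, Finset.sum_range_sub']
    have := realRisingCoeff_pos hx0 R
    simp only [realRisingCoeff, Finset.range_zero, Finset.prod_empty] at this ⊢
    linarith

/-- The sequence decreases to some `L ≥ 0`; if `L > 0`, the preceding summability would make the
harmonic series converge. -/
theorem tendsto_realRisingCoeff (hx0 : 0 < x) (hx1 : x < 1) :
    Tendsto (realRisingCoeff x) atTop (𝓝 0) := by
  have hbdd : BddBelow (Set.range (realRisingCoeff x)) :=
    ⟨0, by rintro _ ⟨r, rfl⟩; exact (realRisingCoeff_pos hx0 r).le⟩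
  have hlim := tendsto_atTop_ciInf (antitone_realRisingCoeff hx0 hx1) hbdd
  set L := ⨅ r, realRisingCoeff x r
  have hL : ∀ r, L ≤ realRisingCoeff x r := fun r ↦ ciInf_le hbdd r
  have hL0 : 0 ≤ L := le_ciInf fun r ↦ (realRisingCoeff_pos hx0 r).le
  rcases hL0.eq_or_lt with h | h
  · rwa [← h] at hlim
  · exfalso
    have h1 : Summable fun r : ℕ ↦ L * (1 / ((r : ℝ) + 1)) := by
      refine (summable_realRisingCoeff_div hx0 hx1).of_nonneg_of_le (fun r ↦ by positivity)
        fun r ↦ ?_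
      rw [mul_one_div]
      have := hL r
      gcongr
    have h2 := (summable_mul_left_iff h.ne').mp h1
    refine Real.not_summable_one_div_natCast ((summable_nat_add_iff 1).mp ?_)
    simpa using h2

theorem norm_risingCoeff_div_le (hx0 : 0 < x) (hx1 : x < 1) {t : ℂ} {R : ℕ} (hR : 1 ≤ t.re + R)
    (r : ℕ) {K : ℝ} {v : ℂ} (hv : ‖v‖ ≤ K / (t + (r + R : ℕ)).re) (hK : 0 ≤ K) :
    ‖risingCoeff x (r + R) * v‖ ≤ K * (realRisingCoeff x r / (r + 1)) := by
  have h1 : realRisingCoeff x (r + R) ≤ realRisingCoeff x r :=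
    antitone_realRisingCoeff hx0 hx1 (Nat.le_add_right r R)
  have h2 := (realRisingCoeff_pos hx0 (r + R)).le
  have h3 : ‖v‖ ≤ K / (r + 1) := by
    refine hv.trans ?_
    push_cast
    simp only [Complex.add_re, Complex.natCast_re]
    exact div_le_div_of_nonneg_left hK (by positivity) (by linarith)
  have h0 := (realRisingCoeff_pos hx0 r).le
  rw [norm_mul, risingCoeff_ofReal, Complex.norm_real, Real.norm_of_nonneg h2]
  calc _ ≤ realRisingCoeff x r * (K / (r + 1)) := by gcongr
    _ = _ := by ring

theorem norm_one_div_le {w : ℂ} (hw : 0 < w.re) : ‖1 / w‖ ≤ 1 / w.re := by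
  rw [norm_div, norm_one]
  exact one_div_le_one_div_of_le hw (Complex.re_le_norm w)

theorem summable_risingCoeff_div (hx0 : 0 < x) (hx1 : x < 1) (t : ℂ) :
    Summable fun r : ℕ ↦ risingCoeff x r * (1 / (t + r)) := by
  obtain ⟨R, hR⟩ := exists_two_le_add_natCast t.re
  refine (summable_nat_add_iff R).mp (Summable.of_norm_bounded
    ((summable_realRisingCoeff_div hx0 hx1).mul_left 1) fun r ↦ ?_)
  refine norm_risingCoeff_div_le hx0 hx1 (by linarith) r (norm_one_div_le ?_) zero_le_one
  push_cast
  simp only [Complex.add_re, Complex.natCast_re]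
  linarith [r.cast_nonneg (α := ℝ)]

/-- The partial fraction expansion `∑ (x)_r / (r! (t + r))` of the beta function `B(t, 1 - x)`. -/
noncomputable def betaSeries (x : ℝ) (t : ℂ) : ℂ := ∑' r : ℕ, risingCoeff x r * (1 / (t + r))

/-- The relation `t B(t,1-x) = (t+1-x) B(t+1,1-x)`. The difference of the two sides telescopes
through `d r = c_r(x) r/(r+t)`, which vanishes at `r = 0` and as `r → ∞`. -/
theorem mul_betaSeries (hx0 : 0 < x) (hx1 : x < 1) {t : ℂ} (ht : ∀ r : ℕ, t + r ≠ 0) :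
    t * betaSeries x t = (t + 1 - x) * betaSeries x (t + 1) := by
  have h1 := (summable_risingCoeff_div hx0 hx1 t).hasSum.mul_left t
  have h2 := (summable_risingCoeff_div hx0 hx1 (t + 1)).hasSum.mul_left (t + 1 - x)
  have h3 := (h1.sub h2).tendsto_sum_nat
  set d : ℕ → ℂ := fun r ↦ risingCoeff x r * (r / (r + t)) with hd
  have hterm : ∀ r : ℕ, t * (risingCoeff x r * (1 / (t + r))) -
      (t + 1 - x) * (risingCoeff x r * (1 / (t + 1 + r))) = d (r + 1) - d r := by
    intro r
    have e1 := ht r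
    have e2 := ht (r + 1)
    have e3 : (r : ℂ) + 1 ≠ 0 := by exact_mod_cast r.succ_ne_zero
    simp only [hd]
    rw [risingCoeff_succ]
    push_cast at e2 ⊢
    rw [show t + 1 + (r : ℂ) = t + (r + 1) by ring, add_comm (r : ℂ) t, add_comm ((r : ℂ) + 1) t]
    field_simp
    ring
  have hd0 : Tendsto d atTop (𝓝 0) := by
    have e1 : Tendsto (fun r : ℕ ↦ risingCoeff x r) atTop (𝓝 0) := by
      simp only [risingCoeff_ofReal]
      have := (Complex.continuous_ofReal.tendsto 0).comp (tendsto_realRisingCoeff hx0 hx1)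
      rwa [Complex.ofReal_zero] at this
    have := e1.mul (tendsto_natCast_div_add_atTop t)
    rwa [zero_mul] at this
  have h4 : Tendsto (fun R ↦ ∑ r ∈ Finset.range R, (d (r + 1) - d r)) atTop (𝓝 0) := by
    have : d 0 = 0 := by simp [hd]
    simpa only [Finset.sum_range_sub, this, sub_zero] using hd0
  simp only [hterm] at h3
  exact sub_eq_zero.mp (tendsto_nhds_unique h3 h4)

/-- Every term has positive real part. -/
theorem betaSeries_ne_zero (hx0 : 0 < x) (hx1 : x < 1) {t : ℂ} (ht : 0 < t.re) :
    betaSeries x t ≠ 0 := by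
  have hsum := summable_risingCoeff_div hx0 hx1 t
  have hre : ∀ r : ℕ, 0 < (risingCoeff x r * (1 / (t + r))).re := by
    intro r
    have h1 : 0 < (t + r).re := by
      simp only [Complex.add_re, Complex.natCast_re]
      positivity
    have h2 : 0 < Complex.normSq (t + r) := Complex.normSq_pos.mpr fun h ↦ by
      rw [h] at h1; simp at h1
    rw [risingCoeff_ofReal, Complex.re_ofReal_mul, one_div, Complex.inv_re]
    have := realRisingCoeff_pos hx0 r
    positivity
  intro h
  have h1 := Complex.hasSum_re hsum.hasSum
  have h2 := h1.summable.tsum_pos (fun r ↦ (hre r).le) 0 (hre 0)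
  rw [h1.tsum_eq] at h2
  rw [betaSeries] at h
  rw [h] at h2
  simp at h2

/-- Shift `t` to the right until `Re t > 0`, where there is no zero; on the way only a factor `t + 1
- x` can vanish. `N` counts the shifts. -/
theorem exists_eq_sub_of_betaSeries_eq_zero (hx0 : 0 < x) (hx1 : x < 1) (N : ℕ) :
    ∀ t : ℂ, 0 < t.re + N → (∀ r : ℕ, t + r ≠ 0) → betaSeries x t = 0 →
      ∃ ν : ℕ, 1 ≤ ν ∧ t = x - ν := by
  induction N with
  | zero => exact fun t h _ h0 ↦ absurd h0 (betaSeries_ne_zero hx0 hx1 (by simpa using h))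
  | succ N ih =>
    intro t h ht h0
    have h1 := mul_betaSeries hx0 hx1 ht
    rw [h0, mul_zero, eq_comm, mul_eq_zero] at h1
    rcases h1 with h1 | h1
    · exact ⟨1, le_rfl, by push_cast; linear_combination h1⟩
    · obtain ⟨ν, -, hν⟩ := ih (t + 1) (by
        push_cast at h; rw [Complex.add_re, Complex.one_re]; linarith)
        (fun r hr ↦ ht (r + 1) (by push_cast; linear_combination hr)) h1
      exact ⟨ν + 1, by omega, by push_cast; linear_combination hν⟩

/-- With `u = -Re w · log q` the left side is at most `u e^(-au)/(1 - e^(-u)) / Re w`, and the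
numerator is bounded by `(1+u) e^(-au) ≤ 1 + 1/a`. The bound is uniform in `q`, as dominated
convergence of the tail requires. -/
theorem norm_log_mul_qGeom_le (ha : 0 < a) (hq0 : 0 < q) (hq1 : q < 1) {w : ℂ} (hw : 0 < w.re) :
    ‖(-Real.log q : ℝ) * qGeom q a w‖ ≤ (1 + 1 / a) / w.re := by
  have hlog : 0 < -Real.log q := by linarith [Real.log_neg hq0 hq1]
  set u := -Real.log q * w.re with hu
  have hu0 : 0 < u := mul_pos hlog hw
  have h1 : q ^ (a * w.re) = Real.exp (-(a * u)) := by
    rw [Real.rpow_def_of_pos hq0, hu]; ring_nf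
  have h2 : 1 - Real.exp (-u) ≤ ‖1 - (q : ℂ) ^ w‖ := by
    have := norm_sub_norm_le (1 : ℂ) ((q : ℂ) ^ w)
    rw [norm_one, Complex.norm_cpow_eq_rpow_re_of_pos hq0, Real.rpow_def_of_pos hq0] at this
    rwa [hu, neg_mul, neg_neg]
  have h3 : u / (1 + u) ≤ 1 - Real.exp (-u) := by
    have h4 : Real.exp (-u) ≤ 1 / (1 + u) := by
      rw [Real.exp_neg, ← one_div]
      exact one_div_le_one_div_of_le (by linarith) (by linarith [Real.add_one_le_exp u])
    have h5 : u / (1 + u) = 1 - 1 / (1 + u) := by field_simp; ring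
    linarith
  have h4 : (1 + u) * Real.exp (-(a * u)) ≤ 1 + 1 / a := by
    rw [Real.exp_neg, ← div_eq_mul_inv, div_le_iff₀ (Real.exp_pos _)]
    calc 1 + u ≤ (1 + 1 / a) * (a * u + 1) := by
          have : (1 + 1 / a) * (a * u + 1) = 1 + u + (a * u + 1 / a) := by field_simp; ring
          rw [this]
          have : 0 < a * u + 1 / a := by positivity
          linarith
      _ ≤ _ := by gcongr; exact Real.add_one_le_exp _
  rw [qGeom, norm_mul, norm_div, norm_ofReal_cpow_mul hq0, h1, Complex.norm_real,
    Real.norm_of_nonneg hlog.le, ← mul_div_assoc]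
  have hl : Real.log q ≠ 0 := (neg_pos.mp hlog).ne
  calc _ ≤ -Real.log q * Real.exp (-(a * u)) / (u / (1 + u)) := by gcongr; exact h3.trans h2
    _ = ((1 + u) * Real.exp (-(a * u))) / w.re := by rw [hu]; field_simp
    _ ≤ _ := by gcongr

theorem tendsto_log_mul_qGeom (a : ℝ) {w : ℂ} (hw : w ≠ 0) :
    Tendsto (fun q : ℝ ↦ ((-Real.log q : ℝ) : ℂ) * qGeom q a w) (𝓝[<] 1) (𝓝 (1 / w)) := by
  have h1 := (Complex.continuous_ofReal.tendsto _).comp tendsto_one_sub_div_neg_log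
  rw [Complex.ofReal_one] at h1
  have h2 := (tendsto_ofReal_cpow_one (a * w)).div (h1.mul (tendsto_cqNumber w)) (by simpa using hw)
  rw [one_mul] at h2
  refine h2.congr' ?_
  filter_upwards [eventually_nhdsLT_one] with q hq
  have h3 : ((1 - q : ℝ) : ℂ) ≠ 0 := by exact_mod_cast (sub_pos.mpr hq.2).ne'
  have h4 : ((-Real.log q : ℝ) : ℂ) ≠ 0 := by
    exact_mod_cast (neg_pos.mpr (Real.log_neg hq.1 hq.2)).ne'
  simp only [Function.comp_apply, Pi.div_apply, qGeom, cqNumber, Complex.ofReal_div]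
  field_simp

theorem tendsto_log_mul_tsum (ha : 0 < a) (hx0 : 0 < x) (hx1 : x < 1) {t : ℂ}
    (ht : ∀ r : ℕ, t + r ≠ 0) :
    Tendsto (fun q : ℝ ↦ ((-Real.log q : ℝ) : ℂ) * ∑' r : ℕ, risingCoeff x r * qGeom q a (t + r))
      (𝓝[<] 1) (𝓝 (betaSeries x t)) := by
  obtain ⟨R, hR⟩ := exists_two_le_add_natCast t.re
  have hterm : ∀ r : ℕ, Tendsto
      (fun q : ℝ ↦ risingCoeff x r * (((-Real.log q : ℝ) : ℂ) * qGeom q a (t + r))) (𝓝[<] 1)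
      (𝓝 (risingCoeff x r * (1 / (t + r)))) := fun r ↦
    (tendsto_log_mul_qGeom a (ht r)).const_mul _
  have hK : 0 ≤ 1 + 1 / a := by positivity
  have htail : Tendsto (fun q : ℝ ↦ ∑' r : ℕ, risingCoeff x (r + R) *
      (((-Real.log q : ℝ) : ℂ) * qGeom q a (t + (r + R : ℕ)))) (𝓝[<] 1)
      (𝓝 (∑' r : ℕ, risingCoeff x (r + R) * (1 / (t + (r + R : ℕ))))) := by
    refine tendsto_tsum_of_dominated_convergence
      ((summable_realRisingCoeff_div hx0 hx1).mul_left (1 + 1 / a)) (fun r ↦ hterm (r + R)) ?_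
    filter_upwards [eventually_nhdsLT_one] with q hq r
    refine norm_risingCoeff_div_le hx0 hx1 (by linarith) r
      (norm_log_mul_qGeom_le ha hq.1 hq.2 ?_) hK
    push_cast
    simp only [Complex.add_re, Complex.natCast_re]
    linarith [r.cast_nonneg (α := ℝ)]
  have h := (tendsto_finsetSum (Finset.range R) fun r _ ↦ hterm r).add htail
  rw [(summable_risingCoeff_div hx0 hx1 t).sum_add_tsum_nat_add] at h
  refine h.congr' ?_
  filter_upwards [eventually_nhdsLT_one] with q hq
  have h1 := (summable_risingCoeff_mul_qGeom hq.1 hq.2 ha x t).mul_left ((-Real.log q : ℝ) : ℂ)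
  rw [← tsum_mul_left, ← h1.sum_add_tsum_nat_add R]
  simp only [mul_left_comm]

/-- If `g_q(x, t, a)` converges as `q ↑ 1`, where `0 < x < 1`, then `t` is one of `x - 1`,
`x - 2`, …, or a pole. -/
theorem exists_eq_sub_of_tendsto_qHurwitz (ha : 0 < a) (hx0 : 0 < x) (hx1 : x < 1) {t : ℂ}
    (ht : ∀ r : ℕ, t + r ≠ 0) {ℓ : ℂ}
    (h : Tendsto (fun q ↦ qHurwitz q a x t) (𝓝[<] 1) (𝓝 ℓ)) : ∃ ν : ℕ, 1 ≤ ν ∧ t = x - ν := by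
  obtain ⟨N, hN⟩ := exists_two_le_add_natCast t.re
  refine exists_eq_sub_of_betaSeries_eq_zero hx0 hx1 N t (by linarith) ht ?_
  -- `-log q` times the series equals `(-log q/(1-q)) (1-q)^(1-x) g_q(x,t,a)`. The first factor
  -- tends to `1` and the second to `0` because `x < 1`.
  have hε : Tendsto (fun q : ℝ ↦ ((1 - q : ℝ) : ℂ) ^ (1 - x : ℂ)) (𝓝[<] 1) (𝓝 0) := by
    have h1 : Continuous fun q : ℝ ↦ ((1 - q : ℝ) : ℂ) ^ (1 - x : ℂ) :=
      (Complex.continuous_ofReal_cpow_const (y := 1 - x) (by simpa using hx1)).comp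
        (continuous_sub_left 1)
    have h2 : (1 - x : ℂ) ≠ 0 := by exact_mod_cast (sub_pos.mpr hx1).ne'
    have h3 := (h1.tendsto 1).mono_left (nhdsWithin_le_nhds (s := Set.Iio 1))
    rwa [sub_self, Complex.ofReal_zero, Complex.zero_cpow h2] at h3
  have hlog : Tendsto (fun q : ℝ ↦ (((1 - q) / (-Real.log q) : ℝ) : ℂ)⁻¹) (𝓝[<] 1) (𝓝 1) := by
    have h1 := (Complex.continuous_ofReal.tendsto _).comp tendsto_one_sub_div_neg_log
    rw [Complex.ofReal_one] at h1
    simpa using h1.inv₀ one_ne_zero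
  have hlim := (hlog.mul hε).mul h
  rw [one_mul, zero_mul] at hlim
  refine tendsto_nhds_unique (tendsto_log_mul_tsum ha hx0 hx1 ht) (hlim.congr' ?_)
  filter_upwards [eventually_nhdsLT_one] with q hq
  have h3 : ((1 - q : ℝ) : ℂ) ≠ 0 := by exact_mod_cast (sub_pos.mpr hq.2).ne'
  have h4 : ((1 - q : ℝ) : ℂ) ^ (x : ℂ) ≠ 0 := by
    rw [Complex.cpow_ne_zero_iff]
    exact Or.inl h3
  rw [qHurwitz, Complex.cpow_sub _ _ h3, Complex.cpow_one, Complex.ofReal_div, inv_div]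
  field_simp

end

/-! ### From single points to meromorphic functions -/

theorem countable_compl_of_mem_codiscrete {S : Set ℂ} (hS : S ∈ codiscrete ℂ) : Sᶜ.Countable := by
  have h := (mem_codiscrete'.mp hS).2
  have := isDiscrete_iff_discreteTopology.mp h
  exact Set.countable_coe_iff.mp (TopologicalSpace.separableSpace_iff_countable.mp inferInstance)

theorem mem_codiscrete_iff_nhdsNE {S : Set ℂ} : S ∈ codiscrete ℂ ↔ ∀ x, S ∈ 𝓝[≠] x := by
  rw [mem_codiscrete]
  simp only [disjoint_principal_right, compl_compl]

/-- Two meromorphic functions on `ℂ` agree, or differ, outside a closed discrete set. -/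
theorem Meromorphic.eventuallyEq_or_eventually_ne {f g : ℂ → ℂ} (hf : Meromorphic f)
    (hg : Meromorphic g) :
    f =ᶠ[codiscrete ℂ] g ∨ ∀ᶠ s in codiscrete ℂ, f s ≠ g s := by
  have hfg : Meromorphic (f - g) := hf.sub hg
  by_cases h : ∃ x, meromorphicOrderAt (f - g) x ≠ ⊤
  · right
    have h1 := hfg.exists_meromorphicOrderAt_ne_top_iff_forall.mp h
    have h2 := (meromorphicOn_univ.mpr hfg).eventually_codiscreteWithin_apply_ne_zero
      fun x _ ↦ h1 x
    exact Eventually.mono h2 fun s hs ↦ sub_ne_zero.mp hs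
  · left
    push Not at h
    refine mem_codiscrete_iff_nhdsNE.mpr fun x ↦ ?_
    exact (meromorphicOrderAt_eq_top_iff.mp (h x)).mono fun z hz ↦ sub_eq_zero.mp hz

/-- The open unit interval meets every set of complex numbers with countable complement. -/
theorem exists_ofReal_mem_of_countable_compl {S : Set ℂ} (hS : Sᶜ.Countable) :
    ∃ x : ℝ, 0 < x ∧ x < 1 ∧ (x : ℂ) ∈ S := by
  have h1 : ((fun x : ℝ ↦ (x : ℂ)) ⁻¹' Sᶜ).Countable :=
    hS.preimage Complex.ofReal_injective
  obtain ⟨x, hx1, hx2⟩ := (h1.dense_compl ℝ).inter_open_nonempty (Set.Ioo 0 1) isOpen_Ioo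
    ⟨1 / 2, by norm_num, by norm_num⟩
  exact ⟨x, hx1.1, hx1.2, by simpa using hx2⟩

section

variable {a : ℝ} {G : ℝ → ℂ → ℂ → ℂ} {φ : ℂ → ℂ}

/-- The constant `-k` lies in the polar set for every `q`, so along such a `φ` there is no regular
point at all. -/
theorem IsTrueQAnalogue.not_eventuallyEq_const (h : IsTrueQAnalogue a G φ) (k : ℕ) :
    ¬ φ =ᶠ[codiscrete ℂ] fun _ ↦ -(k : ℂ) := by
  intro hφ
  have hne : (codiscrete ℂ).NeBot := by
    refine ⟨fun hbot ↦ ?_⟩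
    have h1 := mem_codiscrete_iff_nhdsNE.mp
      (show (∅ : Set ℂ) ∈ codiscrete ℂ by rw [hbot]; trivial) 0
    exact (inferInstance : (𝓝[≠] (0 : ℂ)).NeBot).ne (empty_mem_iff_bot.mp h1)
  obtain ⟨s, hs⟩ := h.1.exists
  obtain ⟨q, hq⟩ := hs.exists
  obtain ⟨z, hz1, hz2⟩ := (hq.1.and (mem_codiscrete_iff_nhdsNE.mp hφ s)).exists
  have hz3 : φ z = -(k : ℂ) := hz2
  rw [hz3] at hz1
  exact hz1 (neg_natCast_mem_qPolarSet k)

theorem IsTrueQAnalogue.exists_eventuallyEq (ha : 0 < a)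
    (hG : ∀ q : ℝ, 0 < q → q < 1 → IsQHurwitz q a (G q)) (hφ : Meromorphic φ)
    (h : IsTrueQAnalogue a G φ) :
    ∃ ν : ℕ, 1 ≤ ν ∧ φ =ᶠ[codiscrete ℂ] fun s ↦ s - (ν : ℂ) := by
  by_contra hcon
  push Not at hcon
  have hmer : ∀ {g : ℂ → ℂ}, Differentiable ℂ g → Meromorphic g := fun hg x ↦
    (hg.analyticAt x).meromorphicAt
  have h1 : ∀ ν : ℕ, ∀ᶠ s in codiscrete ℂ, 1 ≤ ν → φ s ≠ s - (ν : ℂ) := by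
    intro ν
    by_cases hν : 1 ≤ ν
    · exact ((hφ.eventuallyEq_or_eventually_ne (hmer (by fun_prop))).resolve_left
        (hcon ν hν)).mono fun s hs _ ↦ hs
    · exact Eventually.of_forall fun s h ↦ absurd h hν
  have h2 : ∀ k : ℕ, ∀ᶠ s in codiscrete ℂ, φ s ≠ -(k : ℂ) := fun k ↦
    (hφ.eventuallyEq_or_eventually_ne (hmer (differentiable_const _))).resolve_left
      (h.not_eventuallyEq_const k)
  have h3 : ∀ᶠ s in codiscrete ℂ, AnalyticAt ℂ φ s :=
    (meromorphicOn_univ.mpr hφ).eventually_codiscreteWithin_analyticAt φ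
  set S : Set ℂ := {s | (∀ ν : ℕ, 1 ≤ ν → φ s ≠ s - (ν : ℂ)) ∧ (∀ k : ℕ, φ s ≠ -(k : ℂ)) ∧
    AnalyticAt ℂ φ s ∧ ∀ᶠ q in 𝓝[<] (1 : ℝ), RegularAlong q (G q) φ s}
  -- There are infinitely many conditions, so the good set need not be codiscrete, but its
  -- complement is a countable union of countable sets.
  have hS : Sᶜ.Countable := by
    have hsub : Sᶜ ⊆ (⋃ ν : ℕ, {s | 1 ≤ ν → φ s ≠ s - (ν : ℂ)}ᶜ) ∪
        ((⋃ k : ℕ, {s | φ s ≠ -(k : ℂ)}ᶜ) ∪ ({s | AnalyticAt ℂ φ s}ᶜ ∪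
          {s | ∀ᶠ q in 𝓝[<] (1 : ℝ), RegularAlong q (G q) φ s}ᶜ)) := by
      intro s hs
      by_contra hc
      simp only [Set.mem_union, Set.mem_iUnion, not_or, not_exists, Set.mem_compl_iff,
        not_not] at hc
      exact hs ⟨hc.1, hc.2.1, hc.2.2.1, hc.2.2.2⟩
    refine Set.Countable.mono hsub (.union (Set.countable_iUnion fun ν ↦ ?_)
      (.union (Set.countable_iUnion fun k ↦ ?_) (.union ?_ ?_)))
    · exact countable_compl_of_mem_codiscrete (h1 ν)
    · exact countable_compl_of_mem_codiscrete (h2 k)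
    · exact countable_compl_of_mem_codiscrete h3
    · exact countable_compl_of_mem_codiscrete h.1
  obtain ⟨x, hx0, hx1, hν, hk, han, hreg⟩ := exists_ofReal_mem_of_countable_compl hS
  have ht : ∀ r : ℕ, φ x + r ≠ 0 := fun r hr ↦ hk r (eq_neg_of_add_eq_zero_left hr)
  have hlim := h.2 x (by exact_mod_cast hx1.ne) hreg
  obtain ⟨ν, hν1, hν2⟩ := exists_eq_sub_of_tendsto_qHurwitz ha hx0 hx1 ht (hlim.congr' (by
    filter_upwards [eventually_nhdsLT_one, eventually_abs_log_mul_lt (φ x).im] with q hq him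
    have hpol := notMem_qPolarSet hq.1 hq.2 ht him
    have hGq := hG q hq.1 hq.2
    rw [← hGq.eq_qHurwitz hq.1 hq.2 ha x hpol]
    -- Since `φ` is analytic at `x` and `φ x` is off the polar set, the value with singularities
    -- removed is the plain value.
    have hcont : ContinuousAt (fun z ↦ G q z (φ z)) x :=
      ContinuousAt.comp (f := fun z ↦ (z, φ z)) (hGq.holomorphic x (φ x) hpol).continuousAt
        (continuousAt_id.prodMk han.continuousAt)
    exact valueAlong_eq hcont EventuallyEq.rfl))
  exact hν ν hν1 hν2

theorem isTrueQAnalogue_of_eventuallyEq (ha0 : 0 < a) (ha1 : a ≤ 1)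
    (hG : ∀ q : ℝ, 0 < q → q < 1 → IsQHurwitz q a (G q)) {ν : ℕ} (hν : 1 ≤ ν)
    (hφ : φ =ᶠ[codiscrete ℂ] fun s ↦ s - (ν : ℂ)) : IsTrueQAnalogue a G φ := by
  have hloc : ∀ s, φ =ᶠ[𝓝[≠] s] fun s ↦ s - (ν : ℂ) := fun s ↦ mem_codiscrete_iff_nhdsNE.mp hφ s
  have hreg : ∀ q s, RegularAlong q (G q) φ s ↔ RegularAlong q (G q) (fun z ↦ z - (ν : ℂ)) s := by
    intro q s
    have hcomp : (fun z ↦ G q z (φ z)) =ᶠ[𝓝[≠] s] fun z ↦ G q z (z - (ν : ℂ)) :=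
      (hloc s).mono fun z hz ↦ by simp only [hz]
    refine and_congr (eventually_congr ((hloc s).mono fun z hz ↦ by rw [hz])) ?_
    exact exists_congr fun F ↦ and_congr_right fun _ ↦
      ⟨fun h ↦ h.trans hcomp, fun h ↦ h.trans hcomp.symm⟩
  have hval : ∀ q s, valueAlong (G q) φ s = valueAlong (G q) (fun z ↦ z - (ν : ℂ)) s := by
    intro q s
    have hcomp : (fun z ↦ G q z (φ z)) =ᶠ[𝓝[≠] s] fun z ↦ G q z (z - (ν : ℂ)) :=
      (hloc s).mono fun z hz ↦ by simp only [hz]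
    rw [valueAlong, valueAlong, limUnder, limUnder, map_congr hcomp]
  have hmain := regularAlong_sub_natCast ha0 ha1 hG hν
  simp only [IsTrueQAnalogue, hreg, hval]
  refine ⟨?_, fun s _ hs ↦ (hmain s fun j hj1 hjν hsj ↦ ?_).2⟩
  · have hfin : ((fun j : ℕ ↦ (j : ℂ)) '' Set.Icc 1 ν).Finite := (Set.finite_Icc 1 ν).image _
    filter_upwards [hfin.compl_mem_codiscrete] with s hs
    exact (hmain s fun j hj1 hjν hsj ↦ hs ⟨j, ⟨hj1, hjν⟩, hsj.symm⟩).1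
  -- The limit is demanded only at points of regularity, and `1, …, ν` are not among them.
  · obtain ⟨q, hq, hr⟩ := (eventually_nhdsLT_one.and hs).exists
    rw [hsj] at hr
    exact not_regularAlong_natCast hq.1 hq.2 ha0 (hG q hq.1 hq.2) hj1 hjν hr

end

theorem mainTheorem1 (a : ℝ) (ha0 : 0 < a) (ha1 : a ≤ 1) :
    -- the continuations exist
    (∀ q : ℝ, 0 < q → q < 1 → ∃ G : ℂ → ℂ → ℂ, IsQHurwitz q a G) ∧
    ∀ G : ℝ → ℂ → ℂ → ℂ, (∀ q : ℝ, 0 < q → q < 1 → IsQHurwitz q a (G q)) →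
      -- the true `q`-analogues are exactly those with `φ(s) = s - ν`, `ν = 1, 2, 3, …`
      (∀ φ : ℂ → ℂ, Meromorphic φ →
        (IsTrueQAnalogue a G φ ↔
          ∃ ν : ℕ, 1 ≤ ν ∧ φ =ᶠ[codiscrete ℂ] fun s ↦ s - (ν : ℂ))) ∧
      -- for these the limit formula holds at every `s` other than `1, …, ν`
      (∀ ν : ℕ, 1 ≤ ν → ∀ s : ℂ, (∀ j : ℕ, 1 ≤ j → j ≤ ν → s ≠ (j : ℂ)) →
        (∀ᶠ q in 𝓝[<] (1 : ℝ), RegularAlong q (G q) (fun z ↦ z - (ν : ℂ)) s) ∧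
        Tendsto (fun q ↦ valueAlong (G q) (fun z ↦ z - (ν : ℂ)) s) (𝓝[<] (1 : ℝ))
          (𝓝 (HurwitzZeta.hurwitzZeta (a : UnitAddCircle) s))) := by
  refine ⟨fun q hq0 hq1 ↦ ⟨_, isQHurwitz_qHurwitz hq0 hq1 ha0⟩, fun G hG ↦ ⟨fun φ hφ ↦ ⟨?_, ?_⟩,
    fun ν hν ↦ regularAlong_sub_natCast ha0 ha1 hG hν⟩⟩
  · exact fun h ↦ h.exists_eventuallyEq ha0 hG hφ
  · rintro ⟨ν, hν, h⟩
    exact isTrueQAnalogue_of_eventuallyEq ha0 ha1 hG hν h
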